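/- Let $P=(v_0,v_1,\dots,v_n)$ be a simple polygonal chain in $\mathbb{R}^4$, either open ($v_n\ne v_0$) or closed ($v_n=v_0$): its links $s_i=v_iv_{i+1}$ ($0\le i<n$) are non-degenerate segments, two distinct links meet only if they are adjacent, and then only in the endpoint they share (in a closed chain $s_{n-1}$ and $s_0$ are adjacent too). Let $v_k,v_{k+1},\dots,v_{k+4}$ ($0\le k$, $k+4\le n$) be five consecutive vertices of $P$, and suppose that neither joint $v_{k+1}$ nor joint $v_{k+3}$ is straight, i.e. the angles of the chain at these vertices are not $\pi$. The case $v_k=v_{k+4}$, in which $P$ is a closed quadrilateral, is allowed provided that $|v_kv_{k+1}|+|v_{k+1}v_{k+2}|\ne|v_{k+2}v_{k+3}|+|v_{k+3}v_{k+4}|$. Then there are a point $q\neq v_{k+2}$ and a continuous motion $P(t)=(v_0(t),\dots,v_n(t))$, $t\in[0,1]$, with $P(0)=P$, such that: 1. all link lengths are preserved, and all vertices other than $v_{k+1},v_{k+2},v_{k+3}$ stay fixed (in particular $v_k$ and $v_{k+4}$ do); 2. $v_{k+2}$ moves along the ray $L$ from $v_{k+2}$ through $q$, namely $v_{k+2}(t)=v_{k+2}+t(q-v_{k+2})$,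 and its distances to $v_k$ and to $v_{k+4}$ are both strictly increasing in $t$; 3. the whole chain $P(t)$ is simple for every $t\in[0,1]$; 4. at $t=1$ the joint $v_{k+1}$ or the joint $v_{k+3}$ (or both) is straight. -/

import Mathlib

namespace PolygonalChain

/-- Euclidean 4-space. -/
abbrev E4 : Type := EuclideanSpace ℝ (Fin 4)

/-- The `i`-th link of the chain with vertices `v 0, v 1, …`. -/
def link (v : ℕ → E4) (i : ℕ) : Set E4 := segment ℝ (v i) (v (i + 1))

/-- The polygonal chain `(v 0, …, v n)` with the links `0, …, n - 1` is simple. It is closed when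
`v n = v 0` and open otherwise. Only adjacent links meet, and only in the endpoint they share; in
a closed chain the first and the last link are adjacent too. Values `v i` with `n < i` play no
role. -/
structure IsSimple (n : ℕ) (v : ℕ → E4) : Prop where
  ne : ∀ i, i < n → v i ≠ v (i + 1)
  consecutive : ∀ i, i + 1 < n → link v i ∩ link v (i + 1) = {v (i + 1)}
  closing : ∀ i j, i + 1 < j → j < n → (i = 0 ∧ j + 1 = n ∧ v n = v 0) →
    link v i ∩ link v j = {v 0}
  nonadjacent : ∀ i j, i + 1 < j → j < n → ¬ (i = 0 ∧ j + 1 = n ∧ v n = v 0) →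
    link v i ∩ link v j = ∅

/-- The joint `v (i + 1)` between the links `i` and `i + 1` is straight. -/
def StraightAfter (v : ℕ → E4) (i : ℕ) : Prop :=
  EuclideanGeometry.angle (v i) (v (i + 1)) (v (i + 2)) = Real.pi

/-- `x t`, for `t ∈ [0,1]`, is a line tracking motion of the chain `(v 0, …, v n)` which moves its
vertex `v (k + 2)` along the ray from `v (k + 2)` through `q`, from `v (k + 2)` to `q`.
It is a continuous motion that starts at `v`, preserves all link lengths, and
keeps every vertex but `v (k + 1), v (k + 2), v (k + 3)` fixed. -/
structure IsLineTracking (n : ℕ) (v : ℕ → E4) (k : ℕ) (q : E4) (x : ℝ → ℕ → E4) : Prop where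
  continuous : ∀ i, ContinuousOn (fun t => x t i) (Set.Icc 0 1)
  start : x 0 = v
  length : ∀ t ∈ Set.Icc (0 : ℝ) 1, ∀ i, i < n →
    dist (x t i) (x t (i + 1)) = dist (v i) (v (i + 1))
  fixed : ∀ t ∈ Set.Icc (0 : ℝ) 1, ∀ i, i ≠ k + 1 → i ≠ k + 2 → i ≠ k + 3 → x t i = v i
  ray : q ≠ v (k + 2)
  track : ∀ t ∈ Set.Icc (0 : ℝ) 1, x t (k + 2) = v (k + 2) + t • (q - v (k + 2))

end PolygonalChain

/-! Call the five vertices `a, b, c, d, e`. The joint `c` moves along a ray that makes no obtuse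
angle with `c - a` or `c - e`, so that both distances grow strictly, until the first of the arms `a
b c` and `e d c` is straight.

While `a` and `c` are given and the arm is bent, `b` ranges in dimension four over a 2-sphere around
the axis `a c`, and the link `a b` sweeps part of a quadric cone with apex `a`. A line lies on this
cone only if it passes through the apex, and otherwise meets it at most twice. So an obstacle
segment that misses `a` forbids only finitely many positions of `b`, and likewise for the link `c b`
(`exists_finite_subspaces_of_segment_inter`). A sphere minus finitely many points is connected; in
terms of directions of the elbow, planes through the axis have codimension two and do not separate
(`exists_two_segments_of_finrank_le`). The cone can flatten into a hyperplane, where a segment may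
block a whole arc, but the growing distance lets this happen at one time at most.

The free positions over all times form a relatively open set with nonempty slices, connected at all
inner times but one. This suffices to steer the joint through time (`exists_slicePath`,
`exists_elbow_path`).

The joint `b` is moved first, then `d`, with the links at `b` as additional moving obstacles. A
straight arm has no freedom left, so the direction of the ray is chosen generically to keep the
final arms clear (`exists_direction`). Adjacent links of one arm need no care: they meet only in
their joint as long as the distance of the outer ends exceeds the difference of the lengths. -/

open Set Filter Topology

/-! ### Finite unions of subspaces -/

section Avoidance

variable {K V : Type*} [Field K] [Infinite K] [AddCommGroup V] [Module K V]

/-- A subspace that lies in no member of a finite family of subspaces is not covered by them. -/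
theorem Submodule.exists_mem_forall_notMem_of_finite (H : Submodule K V)
    {S : Set (Submodule K V)} (hS : S.Finite) (h : ∀ L ∈ S, ¬ H ≤ L) :
    ∃ u ∈ H, ∀ L ∈ S, u ∉ L := by
  classical
  by_contra! hcon
  have hfin := hS.image (fun L => L.comap H.subtype)
  have hcover : ⋃ p ∈ hfin.toFinset, ((p : Submodule K H) : Set H) = Set.univ := by
    refine Set.eq_univ_of_forall fun u => ?_
    obtain ⟨L, hL, hu⟩ := hcon u u.2
    simp only [Set.mem_iUnion]
    exact ⟨L.comap H.subtype, hfin.mem_toFinset.2 ⟨L, hL, rfl⟩, hu⟩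
  have htop := Subspace.top_mem_of_biUnion_eq_univ hcover
  obtain ⟨L, hL, hLt⟩ := hfin.mem_toFinset.1 htop
  exact h L hL (Submodule.comap_subtype_eq_top.1 hLt)

end Avoidance

/-! ### Paths through the slices of an open set in space-time -/

section TimePath

variable {V : Type*} [TopologicalSpace V]

/-- There is a path in the slices of `P` from `x` at time `s` to `y` at time `t`. -/
def SlicePath (P : ℝ → V → Prop) (s : ℝ) (x : V) (t : ℝ) (y : V) : Prop :=
  ∃ γ : ℝ → V, ContinuousOn γ (Icc s t) ∧ γ s = x ∧ γ t = y ∧ ∀ τ ∈ Icc s t, P τ (γ τ)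

namespace SlicePath

variable {P : ℝ → V → Prop} {s t t' : ℝ} {x y z : V}

theorem trans (hst : s ≤ t) (htt : t ≤ t') (h : SlicePath P s x t y)
    (h' : SlicePath P t y t' z) : SlicePath P s x t' z := by
  obtain ⟨γ, hγ, hs, ht, hP⟩ := h
  obtain ⟨γ', hγ', hs', ht', hP'⟩ := h'
  set δ : ℝ → V := fun τ => if τ ≤ t then γ τ else γ' τ with hδ
  have h1 : ∀ τ, τ ≤ t → δ τ = γ τ := fun τ h => if_pos h
  have h2 : ∀ τ, t ≤ τ → δ τ = γ' τ := fun τ h => by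
    rcases h.eq_or_lt with rfl | h
    · rw [h1 _ le_rfl, ht, hs']
    · exact if_neg h.not_ge
  refine ⟨δ, ?_, by rw [h1 _ hst, hs], by rw [h2 _ htt, ht'], fun τ hτ => ?_⟩
  · rw [← Icc_union_Icc_eq_Icc hst htt]
    exact (hγ.congr fun τ h => h1 τ h.2).union_of_isClosed (hγ'.congr fun τ h => h2 τ h.1)
      isClosed_Icc isClosed_Icc
  · rcases le_total τ t with h | h
    · rw [h1 τ h]; exact hP τ ⟨hτ.1, h⟩
    · rw [h2 τ h]; exact hP' τ ⟨h, hτ.2⟩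

theorem const (h : ∀ τ ∈ Icc s t, P τ x) : SlicePath P s x t x :=
  ⟨fun _ => x, continuousOn_const, rfl, rfl, h⟩

variable [AddCommGroup V] [Module ℝ V] [IsTopologicalAddGroup V] [ContinuousSMul ℝ V]

theorem of_segment (hst : s < t) (h : ∀ τ ∈ Icc s t, ∀ w ∈ segment ℝ x y, P τ w) :
    SlicePath P s x t y := by
  have hne : t - s ≠ 0 := (sub_pos.2 hst).ne'
  refine ⟨fun τ => x + ((τ - s) / (t - s)) • (y - x), by fun_prop, by simp, by simp [hne],
    fun τ hτ => h τ hτ _ ?_⟩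
  rw [segment_eq_image']
  exact ⟨_, ⟨div_nonneg (sub_nonneg.2 hτ.1) (sub_nonneg.2 hst.le),
    (div_le_one (sub_pos.2 hst)).2 (by linarith [hτ.2])⟩, rfl⟩

end SlicePath

variable [AddCommGroup V] [Module ℝ V] [IsTopologicalAddGroup V] [ContinuousSMul ℝ V]

/-- If a relatively open subset of `[0,1] × V` has nonempty slices, and all of its slices at
inner times except one are joined by paths consisting of two segments, then every point of its
first slice is the start of a path `γ` with `γ t` in the slice at `t`. -/
theorem exists_slicePath {P : ℝ → V → Prop}
    (hopen : ∀ t ∈ Icc (0 : ℝ) 1, ∀ x, P t x →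
      ∀ᶠ z : ℝ × V in 𝓝 (t, x), z.1 ∈ Icc (0 : ℝ) 1 → P z.1 z.2)
    (hne : ∀ t ∈ Icc (0 : ℝ) 1, ∃ x, P t x) (t₀ : ℝ)
    (hjoin : ∀ t ∈ Ioo (0 : ℝ) 1, t ≠ t₀ → ∀ x y, P t x → P t y →
      ∃ z, (∀ w ∈ segment ℝ x z, P t w) ∧ ∀ w ∈ segment ℝ z y, P t w)
    {x₀ : V} (hx₀ : P 0 x₀) : ∃ y, SlicePath P 0 x₀ 1 y := by
  have tube : ∀ K : Set V, IsCompact K → ∀ t ∈ Icc (0 : ℝ) 1, (∀ x ∈ K, P t x) →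
      ∃ ε > 0, ∀ s ∈ Icc (0 : ℝ) 1, |s - t| < ε → ∀ x ∈ K, P s x := by
    intro K hK t ht hP
    have := hK.eventually_forall_of_forall_eventually (x₀ := t)
      (P := fun s x => s ∈ Icc (0 : ℝ) 1 → P s x) fun x hx => hopen t ht x (hP x hx)
    obtain ⟨ε, hε, h⟩ := Metric.eventually_nhds_iff.1 this
    exact ⟨ε, hε, fun s hs hst x hx => h (by rwa [Real.dist_eq]) x hx hs⟩
  have hseg : ∀ x y : V, IsCompact (segment ℝ x y) := fun x y => by
    rw [segment_eq_image']
    exact isCompact_Icc.image (by fun_prop)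
  -- From a time near `t` one gets to every later time near `t`.
  have step : ∀ t ∈ Icc (0 : ℝ) 1, ∃ δ > 0, ∀ s ∈ Icc (0 : ℝ) 1, ∀ s' ∈ Icc (0 : ℝ) 1, s < s' →
      |s - t| < δ → |s' - t| < δ → ∀ x, P s x → ∃ y, SlicePath P s x s' y := by
    intro t ht
    obtain ⟨y, hy⟩ := hne t ht
    obtain ⟨δ, hδ, hyδ⟩ := tube {y} isCompact_singleton t ht (by simpa using hy)
    refine ⟨δ, hδ, fun s hs s' hs' hss hsδ hs'δ x hx => ⟨y, ?_⟩⟩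
    obtain ⟨ε, hε, hxε⟩ := tube {x} isCompact_singleton s hs (by simpa using hx)
    simp only [mem_singleton_iff, forall_eq] at hyδ hxε
    have near : ∀ τ ∈ Icc s s', P τ y := fun τ hτ =>
      hyδ τ ⟨hs.1.trans hτ.1, hτ.2.trans hs'.2⟩
        (abs_lt.2 ⟨by linarith [(abs_lt.1 hsδ).1, hτ.1], by linarith [(abs_lt.1 hs'δ).2, hτ.2]⟩)
    -- The point `y` is allowed throughout the neighbourhood of `t`, while `x` is so only shortly
    -- after `s`. The change from `x` to `y` takes place right after a time `r` other than `t₀`: the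
    -- two segments are allowed at `r`, hence by compactness for a short while, within which they
    -- are traversed.
    obtain ⟨r, hr, hr0⟩ : ∃ r ∈ Ioo s (min s' (s + ε)), r ≠ t₀ :=
      ((Ioo_infinite (lt_min hss (by linarith))).sdiff (finite_singleton t₀)).nonempty.imp
        fun _ h => h
    have hrs' := (lt_min_iff.1 hr.2).1
    have hrε := (lt_min_iff.1 hr.2).2
    have hr01 : r ∈ Ioo (0 : ℝ) 1 := ⟨hs.1.trans_lt hr.1, hrs'.trans_le hs'.2⟩
    have stay : ∀ τ ∈ Icc s r, P τ x := fun τ hτ =>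
      hxε τ ⟨hs.1.trans hτ.1, hτ.2.trans hr01.2.le⟩
        (abs_lt.2 ⟨by linarith [hτ.1], by linarith [hτ.2]⟩)
    obtain ⟨z, hxz, hzy⟩ := hjoin r hr01 hr0 x y (stay r ⟨hr.1.le, le_rfl⟩)
      (near r ⟨hr.1.le, hrs'.le⟩)
    obtain ⟨η, hη, hK⟩ := tube _ ((hseg x z).union (hseg z y)) r (Ioo_subset_Icc_self hr01)
      (fun w hw => hw.elim (hxz w) (hzy w))
    set σ := min ((s' - r) / 2) (η / 3)
    have hσ : 0 < σ := lt_min (by linarith) (by linarith)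
    have hσ1 : σ ≤ (s' - r) / 2 := min_le_left _ _
    have hσ2 : σ ≤ η / 3 := min_le_right _ _
    have move : ∀ τ, r ≤ τ → τ ≤ r + 2 * σ → ∀ w ∈ segment ℝ x z ∪ segment ℝ z y, P τ w :=
      fun τ h h' => hK τ ⟨hr01.1.le.trans h, by linarith [hs'.2]⟩
        (abs_lt.2 ⟨by linarith, by linarith⟩)
    refine (SlicePath.const stay).trans hr.1.le hrs'.le ?_
    refine (SlicePath.of_segment (t := r + σ) (y := z) (by linarith) fun τ hτ w hw =>
      move τ hτ.1 (by linarith [hτ.2]) w (.inl hw)).trans (by linarith) (by linarith) ?_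
    refine (SlicePath.of_segment (t := r + 2 * σ) (y := y) (by linarith) fun τ hτ w hw =>
      move τ (by linarith [hτ.1]) hτ.2 w (.inr hw)).trans (by linarith) (by linarith) ?_
    exact SlicePath.const fun τ hτ => near τ ⟨by linarith [hτ.1, hr.1], hτ.2⟩
  set S := {t | t ∈ Icc (0 : ℝ) 1 ∧ ∃ y, SlicePath P 0 x₀ t y}
  have h0 : (0 : ℝ) ∈ S := ⟨by simp, x₀, SlicePath.const (by
    intro τ hτ
    rwa [le_antisymm hτ.2 hτ.1])⟩
  have hbdd : BddAbove S := ⟨1, fun t ht => ht.1.2⟩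
  have hT : sSup S ∈ Icc (0 : ℝ) 1 :=
    ⟨le_csSup hbdd h0, csSup_le ⟨0, h0⟩ fun t ht => ht.1.2⟩
  obtain ⟨δ, hδ, hstep⟩ := step _ hT
  -- The step size depends on the supremum only, so a step begun at an earlier reachable time leads
  -- beyond the supremum unless that is `1`.
  obtain ⟨s, hsS, hs⟩ := exists_lt_of_lt_csSup ⟨0, h0⟩ (sub_lt_self (sSup S) hδ)
  have hsT : s ≤ sSup S := le_csSup hbdd hsS
  have ext : ∀ s' ∈ Icc (0 : ℝ) 1, s < s' → |s' - sSup S| < δ → s' ∈ S := by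
    intro s' hs' hss hd
    obtain ⟨hs01, x, hx⟩ := hsS
    have hPx : P s x := by
      obtain ⟨γ, -, -, h, hP⟩ := hx
      exact h ▸ hP s ⟨hs01.1, le_rfl⟩
    obtain ⟨y, hy⟩ := hstep s hs01 s' hs' hss
      (abs_lt.2 ⟨by linarith, by linarith⟩) hd x hPx
    exact ⟨hs', y, hx.trans hs01.1 hss.le hy⟩
  rcases hT.2.eq_or_lt with h1 | h1
  · rcases hsT.eq_or_lt with h | h
    · rw [h1] at h; exact (h ▸ hsS).2
    · exact (ext 1 (by simp) (by rwa [h1] at h) (by simp [h1, hδ])).2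
  · have hm : sSup S < min 1 (sSup S + δ / 2) := lt_min h1 (by linarith)
    have hm1 : min 1 (sSup S + δ / 2) ≤ 1 := min_le_left _ _
    have hm2 : min 1 (sSup S + δ / 2) ≤ sSup S + δ / 2 := min_le_right _ _
    have := ext _ ⟨hT.1.trans hm.le, hm1⟩ (hsT.trans_lt hm)
      (abs_lt.2 ⟨by linarith, by linarith⟩)
    exact absurd (le_csSup hbdd this) hm.not_ge

end TimePath

/-! ### Complements of subspaces of codimension two -/

section Subspaces

open Module

variable {V : Type*} [AddCommGroup V] [Module ℝ V]

theorem finrank_span_pair_le (x y : V) : finrank ℝ (Submodule.span ℝ {x, y}) ≤ 2 := by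
  classical
  have h := finrank_span_finset_le_card (R := ℝ) ({x, y} : Finset V)
  rw [Finset.coe_pair] at h
  exact h.trans Finset.card_le_two

theorem finrank_span_triple_le (x y z : V) : finrank ℝ (Submodule.span ℝ {x, y, z}) ≤ 3 := by
  classical
  have h := finrank_span_finset_le_card (R := ℝ) ({x, y, z} : Finset V)
  rw [show (({x, y, z} : Finset V) : Set V) = {x, y, z} by simp] at h
  exact h.trans Finset.card_le_three

theorem exists_forall_notMem_of_finrank_lt {S : Set (Submodule ℝ V)} (hS : S.Finite)
    (h : ∀ L ∈ S, finrank ℝ L < finrank ℝ V) : ∃ u, ∀ L ∈ S, u ∉ L := by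
  obtain ⟨u, -, hu⟩ := Submodule.exists_mem_forall_notMem_of_finite ⊤ hS fun L hL htop => by
    have := h L hL
    rw [top_le_iff.1 htop, finrank_top] at this
    exact this.false
  exact ⟨u, hu⟩

variable [FiniteDimensional ℝ V]

/-- Two points of a set that contains the complement of finitely many subspaces of codimension at
least two are joined in it by a path consisting of two segments. -/
theorem exists_two_segments_of_finrank_le {S : Set (Submodule ℝ V)} (hS : S.Finite)
    (h : ∀ L ∈ S, finrank ℝ L + 2 ≤ finrank ℝ V) {A : V → Prop}
    (hA : ∀ ν, (∀ L ∈ S, ν ∉ L) → A ν) {x y : V} (hx : A x) (hy : A y) :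
    ∃ z, (∀ w ∈ segment ℝ x z, A w) ∧ ∀ w ∈ segment ℝ z y, A w := by
  obtain ⟨z, hz⟩ := exists_forall_notMem_of_finrank_lt
    ((hS.image fun L => L ⊔ Submodule.span ℝ {x}).union
      (hS.image fun L => L ⊔ Submodule.span ℝ {y})) (by
    have key : ∀ L ∈ S, ∀ v : V,
        finrank ℝ (L ⊔ Submodule.span ℝ {v} : Submodule ℝ V) < finrank ℝ V := by
      intro L hL v
      have h1 := Submodule.finrank_add_le_finrank_add_finrank L (Submodule.span ℝ {v})
      have h2 : finrank ℝ (Submodule.span ℝ {v}) ≤ 1 := by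
        have := finrank_span_finset_le_card (R := ℝ) ({v} : Finset V)
        rwa [Set.finrank, Finset.coe_singleton, Finset.card_singleton] at this
      have := h L hL
      lia
    rintro _ (⟨L, hL, rfl⟩ | ⟨L, hL, rfl⟩)
    exacts [key L hL x, key L hL y])
  -- A point of the segment other than `v` that lies in `L` would put `z` into `L ⊔ span {v}`. The
  -- point `v` itself may lie in some `L`, but is allowed by assumption.
  have main : ∀ v, A v → (∀ L ∈ S, z ∉ L ⊔ Submodule.span ℝ {v}) →
      ∀ w ∈ segment ℝ v z, A w := by
    intro v hv hzv w hw
    rw [segment_eq_image'] at hw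
    obtain ⟨s, -, rfl⟩ := hw
    rcases eq_or_ne s 0 with rfl | hs
    · simpa using hv
    refine hA _ fun L hL hmem => hzv L hL ?_
    have hvmem : v ∈ L ⊔ Submodule.span ℝ {v} :=
      Submodule.mem_sup_right (Submodule.mem_span_singleton_self v)
    have : z = s⁻¹ • ((v + s • (z - v)) - v) + v := by
      rw [add_sub_cancel_left, smul_smul, inv_mul_cancel₀ hs, one_smul, sub_add_cancel]
    rw [this]
    exact add_mem (Submodule.smul_mem _ _ (sub_mem (Submodule.mem_sup_left hmem) hvmem)) hvmem
  refine ⟨z, main x hx fun L hL => hz _ (.inl ⟨L, hL, rfl⟩), ?_⟩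
  rw [segment_symm]
  exact main y hy fun L hL => hz _ (.inr ⟨L, hL, rfl⟩)

end Subspaces

theorem finite_setOf_quadratic_eq_zero {a b c : ℝ} (h : ¬ (a = 0 ∧ b = 0 ∧ c = 0)) :
    {s : ℝ | a * s ^ 2 + b * s + c = 0}.Finite := by
  open Polynomial in
  have hne : (C a * X ^ 2 + C b * X + C c : ℝ[X]) ≠ 0 := by
    intro h0
    refine h ⟨?_, ?_, ?_⟩
    · simpa [coeff_X, coeff_C] using congrArg (fun p => coeff p 2) h0
    · simpa [coeff_X, coeff_C] using congrArg (fun p => coeff p 1) h0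
    · simpa [coeff_X, coeff_C] using congrArg (fun p => coeff p 0) h0
  refine (Polynomial.finite_setOfPred_isRoot hne).subset fun s hs => ?_
  simpa [Polynomial.IsRoot] using hs

/-- The pairs of meeting segments are the projection of a closed set along the compact square of
parameters. -/
theorem isOpen_setOf_disjoint_segment {V : Type*} [AddCommGroup V] [Module ℝ V]
    [TopologicalSpace V] [IsTopologicalAddGroup V] [ContinuousSMul ℝ V] [T2Space V] :
    IsOpen {q : (V × V) × (V × V) |
      Disjoint (segment ℝ q.1.1 q.1.2) (segment ℝ q.2.1 q.2.2)} := by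
  rw [← isClosed_compl_iff]
  have hcl : IsClosed {z : ((V × V) × (V × V)) × (Icc (0 : ℝ) 1 × Icc (0 : ℝ) 1) |
      z.1.1.1 + (z.2.1 : ℝ) • (z.1.1.2 - z.1.1.1) =
        z.1.2.1 + (z.2.2 : ℝ) • (z.1.2.2 - z.1.2.1)} :=
    isClosed_eq (by fun_prop) (by fun_prop)
  convert! isClosedMap_fst_of_compactSpace _ hcl using 1
  ext q
  simp only [mem_compl_iff, mem_ofPred_eq, Set.not_disjoint_iff, segment_eq_image', mem_image]
  constructor
  · rintro ⟨f, ⟨s, hs, rfl⟩, ⟨s', hs', h⟩⟩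
    exact ⟨⟨q, ⟨s, hs⟩, ⟨s', hs'⟩⟩, h.symm, rfl⟩
  · rintro ⟨⟨q, s, s'⟩, h, rfl⟩
    exact ⟨_, ⟨s, s.2, rfl⟩, ⟨s', s'.2, h.symm⟩⟩

/-! ### Segments meeting a cone of revolution -/

section Cone

open Module

variable {V : Type*} [NormedAddCommGroup V] [InnerProductSpace ℝ V]

/-- The directions in which a segment of length `l` from `o`, of given nonzero component along
`w`, meets another segment lie, modulo `w`, on finitely many lines. -/
theorem exists_finite_subspaces_of_segment_inter (o w x y : V) (l : ℝ) {κ : ℝ} (hκ : κ ≠ 0)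
    (ho : o ∉ segment ℝ x y) :
    ∃ S : Set (Submodule ℝ V), S.Finite ∧ (∀ L ∈ S, finrank ℝ L ≤ 2) ∧
      ∀ m, inner ℝ w (m - o) = κ → ‖m - o‖ = l → ¬ Disjoint (segment ℝ o m) (segment ℝ x y) →
        ∃ L ∈ S, w ∈ L ∧ m - o ∈ L := by
  set g := x - o with hg
  set e := y - x with he
  -- The common point seen from `o` is a multiple of `m - o`. Squaring makes the condition on it
  -- homogeneous, which eliminates the multiple and leaves a quadratic equation for its parameter
  -- `σ` on the line `x y`.
  have meet : ∀ m, inner ℝ w (m - o) = κ → ‖m - o‖ = l →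
      ¬ Disjoint (segment ℝ o m) (segment ℝ x y) →
      ∃ σ s : ℝ, m - o = s • (g + σ • e) ∧
        inner ℝ w (g + σ • e) ^ 2 * l ^ 2 - κ ^ 2 * ‖g + σ • e‖ ^ 2 = 0 := by
    intro m hm hml hd
    obtain ⟨f, hf, hf'⟩ := Set.not_disjoint_iff.1 hd
    have hfo : f ≠ o := fun h => ho (h ▸ hf')
    rw [segment_eq_image'] at hf hf'
    obtain ⟨s, -, hs⟩ := hf
    obtain ⟨σ, -, hσ⟩ := hf'
    have hs0 : s ≠ 0 := by rintro rfl; exact hfo (by simpa using hs.symm)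
    have hgs : g + σ • e = s • (m - o) := by
      have h1 : f - o = s • (m - o) := by rw [← hs]; simp
      rw [← h1, ← hσ, hg, he]; module
    refine ⟨σ, s⁻¹, by rw [hgs, smul_smul, inv_mul_cancel₀ hs0, one_smul], ?_⟩
    rw [hgs, inner_smul_right, hm, norm_smul, hml, Real.norm_eq_abs, mul_pow |s|, sq_abs]
    ring
  have expand : ∀ σ : ℝ, inner ℝ w (g + σ • e) ^ 2 * l ^ 2 - κ ^ 2 * ‖g + σ • e‖ ^ 2 =
      (inner ℝ w e ^ 2 * l ^ 2 - κ ^ 2 * ‖e‖ ^ 2) * σ ^ 2 +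
      (2 * (inner ℝ w g * inner ℝ w e * l ^ 2 - κ ^ 2 * inner ℝ g e)) * σ +
      (inner ℝ w g ^ 2 * l ^ 2 - κ ^ 2 * ‖g‖ ^ 2) := by
    intro σ
    rw [norm_add_sq_real, inner_add_right, inner_smul_right, inner_smul_right, norm_smul, mul_pow,
      Real.norm_eq_abs, sq_abs]
    ring
  by_cases hz : (inner ℝ w e ^ 2 * l ^ 2 - κ ^ 2 * ‖e‖ ^ 2) = 0 ∧
      (2 * (inner ℝ w g * inner ℝ w e * l ^ 2 - κ ^ 2 * inner ℝ g e)) = 0 ∧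
      (inner ℝ w g ^ 2 * l ^ 2 - κ ^ 2 * ‖g‖ ^ 2) = 0
  · obtain ⟨h2, h1, h0⟩ := hz
    have hκ2 : κ ^ 2 ≠ 0 := pow_ne_zero _ hκ
    -- If the quadratic vanishes identically, the line lies on the cone. The squared norm of the
    -- difference, times `κ ^ 2`, is then a combination of the three coefficients, so the line
    -- passes through the apex or degenerates to a point, and all its directions from `o` lie in one
    -- plane with `w`.
    have hdep : inner ℝ w e • g = inner ℝ w g • e := by
      rw [← sub_eq_zero, ← norm_eq_zero, ← sq_eq_zero_iff, norm_sub_sq_real, norm_smul, norm_smul,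
        mul_pow, mul_pow, inner_smul_left, inner_smul_right, Real.norm_eq_abs, sq_abs,
        Real.norm_eq_abs, sq_abs]
      refine (mul_eq_zero.1 ?_).resolve_left hκ2
      simp only [conj_trivial]
      linear_combination (-inner ℝ w e ^ 2) * h0 + inner ℝ w e * inner ℝ w g * h1 -
        inner ℝ w g ^ 2 * h2
    obtain ⟨d, hgd, hed⟩ : ∃ d : V, g ∈ Submodule.span ℝ {w, d} ∧ e ∈ Submodule.span ℝ {w, d} := by
      have hd : ∀ d : V, d ∈ Submodule.span ℝ {w, d} := fun d => Submodule.subset_span (by simp)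
      by_cases hwe : inner ℝ w e = 0
      · refine ⟨g, hd g, ?_⟩
        have : e = 0 := by simpa [hwe, hκ] using h2
        rw [this]; exact zero_mem _
      · refine ⟨e, ?_, hd e⟩
        rw [← inv_smul_smul₀ hwe g, hdep]
        exact Submodule.smul_mem _ _ (Submodule.smul_mem _ _ (hd e))
    refine ⟨{Submodule.span ℝ {w, d}}, finite_singleton _, ?_, fun m hm hml hd => ?_⟩
    · rintro _ rfl; exact finrank_span_pair_le w d
    · obtain ⟨σ, s, h, -⟩ := meet m hm hml hd
      refine ⟨_, rfl, Submodule.subset_span (by simp), ?_⟩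
      rw [h]
      exact Submodule.smul_mem _ _ (add_mem hgd (Submodule.smul_mem _ _ hed))
  · refine ⟨_, (finite_setOf_quadratic_eq_zero hz).image
      fun σ => Submodule.span ℝ {w, g + σ • e}, ?_, fun m hm hml hd => ?_⟩
    · rintro _ ⟨σ, -, rfl⟩; exact finrank_span_pair_le _ _
    · obtain ⟨σ, s, h, h0⟩ := meet m hm hml hd
      refine ⟨_, ⟨σ, by rw [mem_ofPred_eq, ← expand]; exact h0, rfl⟩,
        Submodule.subset_span (by simp), ?_⟩
      rw [h]
      exact Submodule.smul_mem _ _ (Submodule.subset_span (by simp))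

end Cone

/-! ### The elbow over a given axis, parametrized by a direction -/

section Elbow

variable {V : Type*} [NormedAddCommGroup V] [InnerProductSpace ℝ V]

/-- The part of `ν` orthogonal to `w`. -/
noncomputable def orthogonalPart (w ν : V) : V := ν - (inner ℝ w ν / ‖w‖ ^ 2) • w

theorem inner_orthogonalPart (w ν : V) : inner ℝ w (orthogonalPart w ν) = 0 := by
  rcases eq_or_ne w 0 with rfl | hw
  · simp
  · have : ‖w‖ ^ 2 ≠ 0 := by simpa using hw
    rw [orthogonalPart, inner_sub_right, inner_smul_right, real_inner_self_eq_norm_sq]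
    field_simp
    ring

theorem mem_span_of_orthogonalPart_eq_zero {w ν : V} (h : orthogonalPart w ν = 0) :
    ν ∈ Submodule.span ℝ {w} := by
  rw [Submodule.mem_span_singleton]
  exact ⟨_, (sub_eq_zero.1 h).symm⟩

/-- The height, over the side of length `ρ`, of a triangle with the other sides `l` and `l'`. -/
noncomputable def elbowHeight (l l' ρ : ℝ) : ℝ :=
  √(l ^ 2 - ((ρ ^ 2 + l ^ 2 - l' ^ 2) / (2 * ρ)) ^ 2)

/-- The point at distances `l` from `p` and `l'` from `r` in the half-plane bounded by the line
`p r` that contains `p + ν`. -/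
noncomputable def elbow (l l' : ℝ) (p r ν : V) : V :=
  p + ((‖r - p‖ ^ 2 + l ^ 2 - l' ^ 2) / (2 * ‖r - p‖ ^ 2)) • (r - p) +
    (elbowHeight l l' ‖r - p‖ / ‖orthogonalPart (r - p) ν‖) • orthogonalPart (r - p) ν

theorem elbowHeight_sq {l l' ρ : ℝ} (h : |l - l'| ≤ ρ) (hρ : 0 < ρ) (h' : ρ ≤ l + l') :
    elbowHeight l l' ρ ^ 2 = l ^ 2 - ((ρ ^ 2 + l ^ 2 - l' ^ 2) / (2 * ρ)) ^ 2 := by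
  refine Real.sq_sqrt ?_
  obtain ⟨h1, h2⟩ := abs_le.1 h
  -- Heron's formula: the squared height is a product of factors that the triangle inequalities make
  -- nonnegative.
  have : l ^ 2 - ((ρ ^ 2 + l ^ 2 - l' ^ 2) / (2 * ρ)) ^ 2 =
      ((ρ + l - l') * (l' - l + ρ)) * ((l + l' - ρ) * (l + l' + ρ)) / (4 * ρ ^ 2) := by
    field_simp
    ring
  rw [this]
  have a1 : 0 ≤ ρ + l - l' := by linarith
  have a2 : 0 ≤ l' - l + ρ := by linarith
  have a3 : 0 ≤ l + l' - ρ := by linarith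
  have a4 : 0 ≤ l + l' + ρ := by linarith
  positivity

theorem elbowHeight_pos {l l' ρ : ℝ} (h : |l - l'| < ρ) (h' : ρ < l + l') :
    0 < elbowHeight l l' ρ := by
  refine Real.sqrt_pos.2 ?_
  have hρ := (abs_nonneg _).trans_lt h
  obtain ⟨h1, h2⟩ := abs_lt.1 h
  have : l ^ 2 - ((ρ ^ 2 + l ^ 2 - l' ^ 2) / (2 * ρ)) ^ 2 =
      ((ρ + l - l') * (l' - l + ρ)) * ((l + l' - ρ) * (l + l' + ρ)) / (4 * ρ ^ 2) := by
    field_simp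
    ring
  rw [this]
  have a1 : 0 < ρ + l - l' := by linarith
  have a2 : 0 < l' - l + ρ := by linarith
  have a3 : 0 < l + l' - ρ := by linarith
  have a4 : 0 < l + l' + ρ := by linarith
  positivity

variable {l l' : ℝ} {p r ν : V}

theorem inner_elbow_sub_left (h : p ≠ r) :
    inner ℝ (r - p) (elbow l l' p r ν - p) = (‖r - p‖ ^ 2 + l ^ 2 - l' ^ 2) / 2 := by
  have : ‖r - p‖ ≠ 0 := norm_ne_zero_iff.2 (sub_ne_zero.2 h.symm)
  rw [elbow, add_assoc, add_sub_cancel_left, inner_add_right, inner_smul_right, inner_smul_right,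
    inner_orthogonalPart, real_inner_self_eq_norm_sq]
  field_simp
  ring

theorem inner_elbow_sub_right (h : p ≠ r) :
    inner ℝ (r - p) (elbow l l' p r ν - r) = (l ^ 2 - l' ^ 2 - ‖r - p‖ ^ 2) / 2 := by
  rw [show elbow l l' p r ν - r = (elbow l l' p r ν - p) - (r - p) by abel, inner_sub_right,
    inner_elbow_sub_left h, real_inner_self_eq_norm_sq]
  ring

theorem dist_elbow_left (hl : 0 ≤ l) (h : |l - l'| ≤ dist p r) (hpr : p ≠ r)
    (h' : dist p r ≤ l + l') (hν : orthogonalPart (r - p) ν ≠ 0) :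
    dist (elbow l l' p r ν) p = l := by
  rw [dist_comm, dist_eq_norm] at h h'
  have hρ : 0 < ‖r - p‖ := norm_sub_pos_iff.2 hpr.symm
  have hν' : ‖orthogonalPart (r - p) ν‖ ≠ 0 := norm_ne_zero_iff.2 hν
  rw [dist_eq_norm, ← sq_eq_sq₀ (norm_nonneg _) hl, elbow, add_assoc, add_sub_cancel_left,
    norm_add_sq_real, inner_smul_left, inner_smul_right, inner_orthogonalPart, norm_smul, norm_smul,
    mul_pow, mul_pow, Real.norm_eq_abs, sq_abs, Real.norm_eq_abs, sq_abs, div_pow (elbowHeight _ _ _),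
    elbowHeight_sq h hρ h']
  field_simp
  ring

theorem dist_elbow_right (hl : 0 ≤ l) (hl' : 0 ≤ l') (h : |l - l'| ≤ dist p r) (hpr : p ≠ r)
    (h' : dist p r ≤ l + l') (hν : orthogonalPart (r - p) ν ≠ 0) :
    dist (elbow l l' p r ν) r = l' := by
  have h1 := dist_elbow_left hl h hpr h' hν
  rw [dist_eq_norm] at h1
  rw [dist_eq_norm, ← sq_eq_sq₀ (norm_nonneg _) hl',
    show elbow l l' p r ν - r = (elbow l l' p r ν - p) - (r - p) by abel, norm_sub_sq_real, h1,
    real_inner_comm, inner_elbow_sub_left hpr]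
  ring

/-- The direction `ν` is determined by the elbow up to the plane that it spans with the axis. -/
theorem mem_of_elbow_sub_left_mem (hh : elbowHeight l l' ‖r - p‖ ≠ 0)
    (hν : orthogonalPart (r - p) ν ≠ 0) {L : Submodule ℝ V} (hw : r - p ∈ L)
    (hm : elbow l l' p r ν - p ∈ L) : ν ∈ L := by
  have hν' : ‖orthogonalPart (r - p) ν‖ ≠ 0 := norm_ne_zero_iff.2 hν
  rw [elbow, add_assoc, add_sub_cancel_left] at hm
  have h1 := (Submodule.add_mem_iff_right L (Submodule.smul_mem L _ hw)).1 hm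
  have h2 := (Submodule.smul_mem_iff L (div_ne_zero hh hν')).1 h1
  exact (Submodule.sub_mem_iff_left L (Submodule.smul_mem L _ hw)).1 h2

theorem mem_of_elbow_sub_right_mem (hh : elbowHeight l l' ‖r - p‖ ≠ 0)
    (hν : orthogonalPart (r - p) ν ≠ 0) {L : Submodule ℝ V} (hw : r - p ∈ L)
    (hm : elbow l l' p r ν - r ∈ L) : ν ∈ L :=
  mem_of_elbow_sub_left_mem hh hν hw (by simpa using add_mem hm hw)

/-- The two distances force the component of `m - p` along the axis and the norm of its orthogonal
part, which is the height. So every joint off the axis is obtained from its own direction. -/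
theorem elbow_eq {m : V} (hpr : p ≠ r) (hl : dist m p = l) (hl' : dist m r = l')
    (hm : orthogonalPart (r - p) (m - p) ≠ 0) : elbow l l' p r (m - p) = m := by
  have hw : ‖r - p‖ ≠ 0 := norm_ne_zero_iff.2 (sub_ne_zero.2 hpr.symm)
  have hm' : ‖orthogonalPart (r - p) (m - p)‖ ≠ 0 := norm_ne_zero_iff.2 hm
  rw [dist_eq_norm] at hl hl'
  have hin : inner ℝ (r - p) (m - p) = (‖r - p‖ ^ 2 + l ^ 2 - l' ^ 2) / 2 := by
    rw [← hl', show m - r = (m - p) - (r - p) by abel, norm_sub_sq_real (m - p), hl,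
      real_inner_comm]
    ring
  have hα : inner ℝ (r - p) (m - p) / ‖r - p‖ ^ 2 =
      (‖r - p‖ ^ 2 + l ^ 2 - l' ^ 2) / (2 * ‖r - p‖ ^ 2) := by
    rw [hin]; field_simp
  have hnorm : ‖orthogonalPart (r - p) (m - p)‖ = elbowHeight l l' ‖r - p‖ := by
    refine (Real.sqrt_eq_iff_mul_self_eq_of_pos (norm_pos_iff.2 hm)).2 ?_ |>.symm
    rw [← sq, orthogonalPart, norm_sub_sq_real, inner_smul_right,
      real_inner_comm (r - p) (m - p), norm_smul, mul_pow, Real.norm_eq_abs, sq_abs, hα, hin, hl]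
    field_simp
    ring
  rw [elbow, ← hnorm, div_self hm', one_smul]
  conv_lhs => rw [orthogonalPart, hα]
  module

theorem continuousAt_elbow (h : p ≠ r) (hν : orthogonalPart (r - p) ν ≠ 0) :
    ContinuousAt (fun q : (V × V) × V => elbow l l' q.1.1 q.1.2 q.2) ((p, r), ν) := by
  have hw : ‖r - p‖ ≠ 0 := norm_ne_zero_iff.2 (sub_ne_zero.2 h.symm)
  have hν' : ‖orthogonalPart (r - p) ν‖ ≠ 0 := norm_ne_zero_iff.2 hν
  have hw2 : ‖r - p‖ ^ 2 ≠ 0 := pow_ne_zero _ hw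
  have hw3 : 2 * ‖r - p‖ ^ 2 ≠ 0 := mul_ne_zero two_ne_zero hw2
  have hw4 : 2 * ‖r - p‖ ≠ 0 := mul_ne_zero two_ne_zero hw
  have hc : ContinuousAt (fun q : (V × V) × V => orthogonalPart (q.1.2 - q.1.1) q.2)
      ((p, r), ν) := by
    unfold orthogonalPart
    fun_prop (disch := assumption)
  unfold elbow elbowHeight
  fun_prop (disch := assumption)

end Elbow

/-! ### Steering one joint around moving obstacles -/

section ElbowPath

open Module

variable {V : Type*} [NormedAddCommGroup V] [InnerProductSpace ℝ V]

/-- While the endpoints `p` and `r` of a chain of two links of lengths `l` and `l'` move apart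
until the chain is straight at the earliest at the end of the motion, the middle joint can be
moved so that the links stay clear of finitely many moving segments. The segment `x j`, `y j` is
an obstacle for the link at the endpoint `o j`, and never contains that endpoint. -/
theorem exists_elbow_path (hdim : 4 ≤ finrank ℝ V) {ι : Type*} [Finite ι] {p r : ℝ → V}
    {o x y : ι → ℝ → V} (hp : Continuous p) (hr : Continuous r)
    (ho : ∀ j, o j = p ∨ o j = r) (hx : ∀ j, Continuous (x j)) (hy : ∀ j, Continuous (y j))
    {l l' : ℝ} (hl : 0 ≤ l) (hl' : 0 ≤ l')
    (hmono : StrictMonoOn (fun t => dist (p t) (r t)) (Icc 0 1))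
    (hlow : |l - l'| < dist (p 0) (r 0)) (hhigh : dist (p 1) (r 1) ≤ l + l')
    (hoxy : ∀ t ∈ Icc (0 : ℝ) 1, ∀ j, o j t ∉ segment ℝ (x j t) (y j t))
    (hend : dist (p 1) (r 1) = l + l' → ∀ m, dist m (p 1) = l → dist m (r 1) = l' →
      ∀ j, Disjoint (segment ℝ (o j 1) m) (segment ℝ (x j 1) (y j 1)))
    {m₀ : V} (hm₀p : dist m₀ (p 0) = l) (hm₀r : dist m₀ (r 0) = l')
    (hm₀ : ∀ j, Disjoint (segment ℝ (o j 0) m₀) (segment ℝ (x j 0) (y j 0))) :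
    ∃ m : ℝ → V, Continuous m ∧ m 0 = m₀ ∧ ∀ t ∈ Icc (0 : ℝ) 1,
      dist (m t) (p t) = l ∧ dist (m t) (r t) = l' ∧
      ∀ j, Disjoint (segment ℝ (o j t) (m t)) (segment ℝ (x j t) (y j t)) := by
  classical
  have : FiniteDimensional ℝ V := Module.finite_of_finrank_pos (by lia)
  have h0I : (0 : ℝ) ∈ Icc (0 : ℝ) 1 := by simp
  have h1I : (1 : ℝ) ∈ Icc (0 : ℝ) 1 := by simp
  have hlow' : ∀ t ∈ Icc (0 : ℝ) 1, |l - l'| < dist (p t) (r t) := fun t ht =>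
    hlow.trans_le (hmono.monotoneOn h0I ht ht.1)
  have hhigh' : ∀ t ∈ Icc (0 : ℝ) 1, dist (p t) (r t) ≤ l + l' := fun t ht =>
    (hmono.monotoneOn ht h1I ht.2).trans hhigh
  have hhigh'' : ∀ t ∈ Icc (0 : ℝ) 1, t < 1 → dist (p t) (r t) < l + l' := fun t ht h =>
    (hmono ht h1I h).trans_le hhigh
  have hpr : ∀ t ∈ Icc (0 : ℝ) 1, p t ≠ r t := fun t ht =>
    dist_pos.1 ((abs_nonneg _).trans_lt (hlow' t ht))
  have hnorm : ∀ t, ‖r t - p t‖ = dist (p t) (r t) := fun t => by rw [dist_comm, dist_eq_norm]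
  have hheight : ∀ t ∈ Icc (0 : ℝ) 1, dist (p t) (r t) < l + l' →
      elbowHeight l l' ‖r t - p t‖ ≠ 0 := fun t ht h => by
    rw [hnorm]; exact (elbowHeight_pos (hlow' t ht) h).ne'
  -- The direction `ν` is steered rather than the joint: the elbow is continuous in it even at a
  -- final time at which the height is zero and `ν` has no effect any more.
  set P : ℝ → V → Prop := fun t ν => orthogonalPart (r t - p t) ν ≠ 0 ∧
    ∀ j, Disjoint (segment ℝ (o j t) (elbow l l' (p t) (r t) ν)) (segment ℝ (x j t) (y j t))
    with hP
  have hmem : ∀ t ∈ Icc (0 : ℝ) 1, dist (p t) (r t) < l + l' → ∀ ν,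
      orthogonalPart (r t - p t) ν ≠ 0 → ∀ j, ∀ L : Submodule ℝ V, r t - p t ∈ L →
      elbow l l' (p t) (r t) ν - o j t ∈ L → ν ∈ L := by
    intro t ht hd ν hν j L hL hm
    rcases ho j with h | h <;> rw [h] at hm
    · exact mem_of_elbow_sub_left_mem (hheight t ht hd) hν hL hm
    · exact mem_of_elbow_sub_right_mem (hheight t ht hd) hν hL hm
  have hopen : ∀ t ∈ Icc (0 : ℝ) 1, ∀ ν, P t ν →
      ∀ᶠ z : ℝ × V in 𝓝 (t, ν), z.1 ∈ Icc (0 : ℝ) 1 → P z.1 z.2 := by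
    rintro t ht ν ⟨hν, hd⟩
    have hpc : ContinuousAt (fun z : ℝ × V => p z.1) (t, ν) := by fun_prop
    have hrc : ContinuousAt (fun z : ℝ × V => r z.1) (t, ν) := by fun_prop
    have hoc : ∀ j, Continuous (o j) := fun j => by rcases ho j with h | h <;> rwa [h]
    have hmc : ContinuousAt (fun z : ℝ × V => elbow l l' (p z.1) (r z.1) z.2) (t, ν) :=
      (continuousAt_elbow (hpr t ht) hν).comp (f := fun z : ℝ × V => ((p z.1, r z.1), z.2))
        (x := (t, ν)) (by fun_prop)
    have hne : ‖r t - p t‖ ^ 2 ≠ 0 :=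
      pow_ne_zero _ (norm_ne_zero_iff.2 (sub_ne_zero.2 (hpr t ht).symm))
    have hwc : ContinuousAt (fun z : ℝ × V => orthogonalPart (r z.1 - p z.1) z.2) (t, ν) := by
      unfold orthogonalPart
      fun_prop (disch := assumption)
    have h1 := hwc.eventually_ne hν
    have h2 : ∀ᶠ z : ℝ × V in 𝓝 (t, ν), ∀ j, Disjoint
        (segment ℝ (o j z.1) (elbow l l' (p z.1) (r z.1) z.2)) (segment ℝ (x j z.1) (y j z.1)) := by
      refine eventually_all.2 fun j => ?_
      have hc : ContinuousAt (fun z : ℝ × V =>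
          (((o j z.1, elbow l l' (p z.1) (r z.1) z.2), (x j z.1, y j z.1)) :
            (V × V) × (V × V))) (t, ν) := by
        have h1 := hoc j
        have h2 := hx j
        have h3 := hy j
        refine ContinuousAt.prodMk (ContinuousAt.prodMk ?_ hmc) ?_ <;> fun_prop
      exact hc.eventually (isOpen_setOf_disjoint_segment.mem_nhds (hd j))
    filter_upwards [h1, h2] with z h1 h2 _
    exact ⟨h1, h2⟩
  -- This holds at the exceptional time too: a bent elbow whose link meets the obstacle has its
  -- direction in the span of the axis and the obstacle seen from `o j`, of dimension at most three.
  -- A straight elbow is covered by `hend`.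
  have hne : ∀ t ∈ Icc (0 : ℝ) 1, ∃ ν, P t ν := by
    intro t ht
    obtain ⟨ν, hν⟩ := exists_forall_notMem_of_finrank_lt
      (S := insert (Submodule.span ℝ {r t - p t, r t - p t})
        (range fun j => Submodule.span ℝ {r t - p t, x j t - o j t, y j t - o j t}))
      ((finite_range _).insert _) (by
        rintro _ (rfl | ⟨j, rfl⟩)
        · exact (finrank_span_pair_le _ _).trans_lt (by lia)
        · exact (finrank_span_triple_le _ _ _).trans_lt (by lia))
    have hν0 : orthogonalPart (r t - p t) ν ≠ 0 := fun h =>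
      hν _ (.inl rfl) (by simpa using mem_span_of_orthogonalPart_eq_zero h)
    refine ⟨ν, hν0, fun j => ?_⟩
    rcases (hhigh' t ht).eq_or_lt with hd | hd
    · have ht1 : t = 1 := by
        by_contra h
        exact (hhigh'' t ht (lt_of_le_of_ne ht.2 h)).ne hd
      subst ht1
      exact hend hd _ (dist_elbow_left hl (hlow' _ ht).le (hpr _ ht) (hhigh' _ ht) hν0)
        (dist_elbow_right hl hl' (hlow' _ ht).le (hpr _ ht) (hhigh' _ ht) hν0) j
    · by_contra hdis
      obtain ⟨f, hf, hf'⟩ := Set.not_disjoint_iff.1 hdis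
      have hfo : f ≠ o j t := fun h => hoxy t ht j (h ▸ hf')
      rw [segment_eq_image'] at hf
      obtain ⟨s, -, rfl⟩ := hf
      have hs : s ≠ 0 := by rintro rfl; simp at hfo
      refine hν _ (.inr ⟨j, rfl⟩) (hmem t ht hd ν hν0 j _ (Submodule.subset_span (by simp)) ?_)
      rw [← Submodule.smul_mem_iff _ hs]
      rw [segment_eq_image'] at hf'
      obtain ⟨σ, -, hσ⟩ := hf'
      have : s • (elbow l l' (p t) (r t) ν - o j t) =
          (1 - σ) • (x j t - o j t) + σ • (y j t - o j t) := by
        have h := congrArg (· - o j t) hσ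
        simp only [add_sub_cancel_left] at h
        rw [← h]; module
      rw [this]
      exact add_mem (Submodule.smul_mem _ _ (Submodule.subset_span (by simp)))
        (Submodule.smul_mem _ _ (Submodule.subset_span (by simp)))
  -- The component of a link along the axis is half of `ρ ^ 2 + l ^ 2 - l' ^ 2` or `l ^ 2 - l' ^ 2 -
  -- ρ ^ 2`, where `ρ` is the distance of the endpoints. It vanishes, and the cone is flat, only if
  -- `ρ ^ 2 = |l ^ 2 - l' ^ 2|`, which the strictly growing `ρ` satisfies at most once.
  obtain ⟨t₀, ht₀⟩ : ∃ t₀ : ℝ, ∀ t ∈ Ioo (0 : ℝ) 1, t ≠ t₀ →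
      dist (p t) (r t) ^ 2 ≠ |l ^ 2 - l' ^ 2| := by
    by_cases h : ∃ t₀ ∈ Ioo (0 : ℝ) 1, dist (p t₀) (r t₀) ^ 2 = |l ^ 2 - l' ^ 2|
    · obtain ⟨t₀, ht₀, h₀⟩ := h
      refine ⟨t₀, fun t ht hne h => hne ?_⟩
      rw [← h₀, sq_eq_sq₀ dist_nonneg dist_nonneg] at h
      exact hmono.injOn (Ioo_subset_Icc_self ht) (Ioo_subset_Icc_self ht₀) h
    · push Not at h
      exact ⟨0, fun t ht _ => h t ht⟩
  have hjoin : ∀ t ∈ Ioo (0 : ℝ) 1, t ≠ t₀ → ∀ ν ν', P t ν → P t ν' →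
      ∃ z, (∀ w ∈ segment ℝ ν z, P t w) ∧ ∀ w ∈ segment ℝ z ν', P t w := by
    intro t ht htne ν ν' hν hν'
    have htI := Ioo_subset_Icc_self ht
    have hd := hhigh'' t htI ht.2
    have hgen := ht₀ t ht htne
    have hcone : ∀ j, ∃ S : Set (Submodule ℝ V), S.Finite ∧ (∀ L ∈ S, finrank ℝ L ≤ 2) ∧
        ∀ ν, orthogonalPart (r t - p t) ν ≠ 0 →
          ¬ Disjoint (segment ℝ (o j t) (elbow l l' (p t) (r t) ν))
            (segment ℝ (x j t) (y j t)) → ∃ L ∈ S, ν ∈ L := by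
      intro j
      obtain ⟨κ, c, hκ, hin, hlen⟩ : ∃ κ c : ℝ, κ ≠ 0 ∧
          (∀ ν, orthogonalPart (r t - p t) ν ≠ 0 →
            inner ℝ (r t - p t) (elbow l l' (p t) (r t) ν - o j t) = κ) ∧
          ∀ ν, orthogonalPart (r t - p t) ν ≠ 0 →
            ‖elbow l l' (p t) (r t) ν - o j t‖ = c := by
        rcases ho j with h | h
        · refine ⟨_, l, ?_, fun ν hν => by rw [h, inner_elbow_sub_left (hpr t htI)],
            fun ν hν => by
              rw [h, ← dist_eq_norm]
              exact dist_elbow_left hl (hlow' t htI).le (hpr t htI) hd.le hν⟩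
          intro h0
          rw [hnorm] at h0
          refine hgen ?_
          rw [abs_of_nonpos (by nlinarith [sq_nonneg (dist (p t) (r t))])]
          linarith
        · refine ⟨_, l', ?_, fun ν hν => by rw [h, inner_elbow_sub_right (hpr t htI)],
            fun ν hν => by
              rw [h, ← dist_eq_norm]
              exact dist_elbow_right hl hl' (hlow' t htI).le (hpr t htI) hd.le hν⟩
          intro h0
          rw [hnorm] at h0
          refine hgen ?_
          rw [abs_of_nonneg (by nlinarith [sq_nonneg (dist (p t) (r t))])]
          linarith
      obtain ⟨S, hS, hS2, hSmem⟩ := exists_finite_subspaces_of_segment_inter (o j t) (r t - p t)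
        (x j t) (y j t) c hκ (hoxy t htI j)
      refine ⟨S, hS, hS2, fun ν hν hdis => ?_⟩
      obtain ⟨L, hL, hwL, hmL⟩ := hSmem _ (hin ν hν) (hlen ν hν) hdis
      exact ⟨L, hL, hmem t htI hd ν hν j L hwL hmL⟩
    choose S hS hS2 hSmem using hcone
    refine exists_two_segments_of_finrank_le
      (S := insert (Submodule.span ℝ {r t - p t, r t - p t}) (⋃ j, S j))
      ((finite_iUnion hS).insert _) ?_ (A := P t) ?_ hν hν'
    · rintro L (rfl | hL)
      · have := finrank_span_pair_le (r t - p t) (r t - p t)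
        lia
      · obtain ⟨j, hj⟩ := mem_iUnion.1 hL
        have := hS2 j L hj
        lia
    · intro ν hν
      have hν0 : orthogonalPart (r t - p t) ν ≠ 0 := fun h =>
        hν _ (.inl rfl) (by simpa using mem_span_of_orthogonalPart_eq_zero h)
      refine ⟨hν0, fun j => ?_⟩
      by_contra hdis
      obtain ⟨L, hL, hνL⟩ := hSmem j ν hν0 hdis
      exact hν L (.inr (mem_iUnion.2 ⟨j, hL⟩)) hνL
  -- A joint on the axis, at `p + s • (r - p)`, has `|s| + |s - 1| = 1` or `||s| - |s - 1|| = 1`,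
  -- against the strict triangle inequalities at time `0`.
  have hν₀ : orthogonalPart (r 0 - p 0) (m₀ - p 0) ≠ 0 := by
    intro h
    obtain ⟨s, hs⟩ := Submodule.mem_span_singleton.1 (mem_span_of_orthogonalPart_eq_zero h)
    have h1 : l = |s| * ‖r 0 - p 0‖ := by
      rw [← hm₀p, dist_eq_norm, ← hs, norm_smul, Real.norm_eq_abs]
    have h2 : l' = |s - 1| * ‖r 0 - p 0‖ := by
      rw [← hm₀r, dist_eq_norm, show m₀ - r 0 = (s - 1) • (r 0 - p 0) by
        rw [sub_smul, hs, one_smul]; abel, norm_smul, Real.norm_eq_abs]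
    have h3 := hlow
    have h4 := hhigh'' 0 h0I one_pos
    rw [← hnorm] at h3 h4
    have hρ : 0 < ‖r 0 - p 0‖ := (abs_nonneg _).trans_lt h3
    rw [h1, h2, ← sub_mul, abs_mul, abs_of_pos hρ] at h3
    rw [h1, h2, ← add_mul] at h4
    have h3' : |(|s| - |s - 1|)| < 1 := by
      by_contra! hc; nlinarith
    have h4' : 1 < |s| + |s - 1| := by
      by_contra! hc; nlinarith
    rcases abs_cases s with ⟨h5, h6⟩ | ⟨h5, h6⟩ <;>
      rcases abs_cases (s - 1) with ⟨h7, h8⟩ | ⟨h7, h8⟩ <;> rw [h5, h7] at h3' h4' <;>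
      rw [abs_lt] at h3' <;> linarith [h3'.1, h3'.2]
  have hstart : elbow l l' (p 0) (r 0) (m₀ - p 0) = m₀ := elbow_eq (hpr 0 h0I) hm₀p hm₀r hν₀
  obtain ⟨-, γ, hγ, hγ0, -, hγP⟩ := exists_slicePath hopen hne t₀ hjoin (x₀ := m₀ - p 0)
    ⟨hν₀, fun j => by rw [hstart]; exact hm₀ j⟩
  have hcont : ContinuousOn (fun t => elbow l l' (p t) (r t) (γ t)) (Icc 0 1) := fun t ht =>
    (continuousAt_elbow (hpr t ht) (hγP t ht).1).comp_continuousWithinAt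
      (f := fun t => ((p t, r t), γ t)) (x := t)
      ((hp.continuousWithinAt.prodMk hr.continuousWithinAt).prodMk (hγ t ht))
  -- The path is extended to all times because a later application takes it as a moving obstacle,
  -- required to be continuous on `ℝ`.
  refine ⟨IccExtend zero_le_one (domRestrict (Icc 0 1) fun t => elbow l l' (p t) (r t) (γ t)),
    (continuousOn_iff_continuous_domRestrict.1 hcont).Icc_extend', ?_, fun t ht => ?_⟩
  · rw [IccExtend_of_mem _ _ h0I, domRestrict_apply, hγ0, hstart]
  · rw [IccExtend_of_mem _ _ ht, domRestrict_apply]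
    exact ⟨dist_elbow_left hl (hlow' t ht).le (hpr t ht) (hhigh' t ht) (hγP t ht).1,
      dist_elbow_right hl hl' (hlow' t ht).le (hpr t ht) (hhigh' t ht) (hγP t ht).1,
      (hγP t ht).2⟩

end ElbowPath

/-! ### Meeting segments, and obstacles that end at the apex -/

section Segments

variable {V : Type*} [NormedAddCommGroup V] [InnerProductSpace ℝ V]

theorem mem_segment_of_dist_add_dist_eq {a b c : V} (h : dist a b + dist b c = dist a c) :
    b ∈ segment ℝ a c :=
  mem_segment_iff_wbtw.2 (dist_add_dist_eq_iff.1 h)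

theorem dist_le_of_mem_segment {a b f : V} (h : f ∈ segment ℝ a b) : dist a f ≤ dist a b := by
  have := dist_add_dist_of_mem_segment h
  linarith [dist_nonneg (x := f) (y := b)]

/-- A common point other than `b` would put `a` and `c` on one ray from `b`, making `dist a c` the
difference of the lengths. The inequality persists while `dist a c` grows; `abs_dist_sub_dist_lt`
supplies it at the start. -/
theorem eq_of_mem_segments_of_abs_lt {a b c f : V} (h : |dist b a - dist b c| < dist a c)
    (hf : f ∈ segment ℝ a b) (hf' : f ∈ segment ℝ c b) : f = b := by
  rw [segment_symm, segment_eq_image'] at hf hf'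
  obtain ⟨s, hs, rfl⟩ := hf
  obtain ⟨s', hs', h'⟩ := hf'
  rcases hs.1.eq_or_lt with rfl | hs0
  · simp
  rcases hs'.1.eq_or_lt with rfl | hs0'
  · simpa using h'.symm
  have hray : SameRay ℝ (a - b) (c - b) :=
    .inr (.inr ⟨s, s', hs0, hs0', (add_left_cancel h').symm⟩)
  have := hray.norm_sub
  rw [sub_sub_sub_cancel_right, ← dist_eq_norm, ← dist_eq_norm, ← dist_eq_norm, dist_comm a b,
    dist_comm c b] at this
  exact absurd this h.ne'

theorem abs_dist_sub_dist_lt {a b c : V} (hab : a ≠ b) (hcb : c ≠ b)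
    (h : ∀ f ∈ segment ℝ a b, f ∈ segment ℝ c b → f = b) : |dist b a - dist b c| < dist a c := by
  have key : ∀ a c : V, c ≠ b → (∀ f ∈ segment ℝ a b, f ∈ segment ℝ c b → f = b) →
      dist b a - dist b c < dist a c := by
    intro a c hcb h
    by_contra! hle
    have h1 := dist_triangle a c b
    rw [dist_comm a b, dist_comm c b] at h1
    refine hcb (h c (mem_segment_of_dist_add_dist_eq ?_) (left_mem_segment ℝ c b))
    rw [dist_comm c b, dist_comm a b]
    linarith
  refine abs_lt.2 ⟨?_, key a c hcb h⟩
  have := key c a hab fun f hf hf' => h f hf' hf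
  rw [dist_comm c a] at this
  linarith

/-- Two segments that start at `o` meet only there if the shorter one does not end on the ray
spanned by the other. -/
theorem disjoint_singleton_ray_iff {o m y : V} {l : ℝ} (hl : 0 < l) (hm : dist m o = l)
    (hy : y ≠ o) :
    Disjoint (segment ℝ o m) (segment ℝ (o + (l / dist y o) • (y - o))
      (o + (l / dist y o) • (y - o))) ↔
      ∀ f ∈ segment ℝ o m, f ∈ segment ℝ o y → f = o := by
  have hd : 0 < dist y o := dist_pos.2 hy
  rw [segment_same, Set.disjoint_singleton_right]
  constructor
  · intro h f hf hf'
    by_contra hfo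
    refine h ?_
    rw [segment_eq_image'] at hf hf'
    obtain ⟨s, hs, rfl⟩ := hf
    obtain ⟨s', hs', h'⟩ := hf'
    have hs0 : 0 < s := hs.1.lt_of_ne (by rintro rfl; simp at hfo)
    have h1 : s' • (y - o) = s • (m - o) := add_left_cancel h'
    have h2 : s' * dist y o = s * l := by
      have := congrArg norm h1
      rwa [norm_smul, norm_smul, Real.norm_of_nonneg hs.1, Real.norm_of_nonneg hs'.1,
        ← dist_eq_norm, ← dist_eq_norm, hm] at this
    have h3 : l / dist y o = s⁻¹ * s' := by
      field_simp
      linarith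
    rw [h3, mul_smul, h1, smul_smul, inv_mul_cancel₀ hs0.ne', one_smul, add_sub_cancel]
    exact right_mem_segment ℝ o m
  · intro h hz
    set z := o + (l / dist y o) • (y - o) with hzdef
    have hc : 0 < l / dist y o := div_pos hl hd
    -- The point at distance `min l (dist y o)` from `o` on the ray, common to both segments.
    set s := min 1 (dist y o / l) with hs
    have hs0 : 0 < s := lt_min one_pos (div_pos hd hl)
    have hs1 : s ≤ 1 := min_le_left _ _
    have hs2 : s * (l / dist y o) ≤ 1 := by
      have : s ≤ dist y o / l := min_le_right _ _
      calc s * (l / dist y o) ≤ dist y o / l * (l / dist y o) := by gcongr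
        _ = 1 := by field_simp
    have hmem : o + s • (z - o) ∈ segment ℝ o m := by
      have : o + s • (z - o) ∈ segment ℝ o z := by
        rw [segment_eq_image']
        exact ⟨s, ⟨hs0.le, hs1⟩, rfl⟩
      exact (convex_segment o m).segment_subset (left_mem_segment ℝ o m) hz this
    have hmem' : o + s • (z - o) ∈ segment ℝ o y := by
      rw [segment_eq_image']
      refine ⟨s * (l / dist y o), ⟨by positivity, hs2⟩, ?_⟩
      simp only [hzdef, add_sub_cancel_left, smul_smul]
    have h0 := h _ hmem hmem'
    rw [add_eq_left, smul_eq_zero, hzdef, add_sub_cancel_left, smul_eq_zero, sub_eq_zero] at h0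
    rcases h0 with h0 | h0 | h0
    exacts [hs0.ne' h0, hc.ne' h0, hy h0]

theorem notMem_singleton_ray {o y : V} {l : ℝ} (hl : 0 < l) (hy : y ≠ o) :
    o ∉ segment ℝ (o + (l / dist y o) • (y - o)) (o + (l / dist y o) • (y - o)) := by
  rw [segment_same, Set.mem_singleton_iff, left_eq_add, smul_eq_zero, sub_eq_zero]
  rintro (h | h)
  exacts [(div_pos hl (dist_pos.2 hy)).ne' h, hy h]

/-- A segment which may end at `o` can be replaced, as an obstacle for segments of length `l` from
`o`, by one which does not contain `o`. -/
theorem exists_obstacle {o x y : V} {l : ℝ} (hl : 0 < l)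
    (ho : o ∈ segment ℝ x y → (x = o ∧ y ≠ o) ∨ (y = o ∧ x ≠ o)) :
    ∃ X Y : V, o ∉ segment ℝ X Y ∧ ∀ m, dist m o = l →
      (Disjoint (segment ℝ o m) (segment ℝ X Y) ↔
        ∀ f ∈ segment ℝ o m, f ∈ segment ℝ x y → f = o) := by
  by_cases h : o ∈ segment ℝ x y
  · rcases ho h with ⟨rfl, hy⟩ | ⟨rfl, hx⟩
    · exact ⟨_, _, notMem_singleton_ray hl hy, fun m hm => disjoint_singleton_ray_iff hl hm hy⟩
    · rw [segment_symm]
      exact ⟨_, _, notMem_singleton_ray hl hx, fun m hm => disjoint_singleton_ray_iff hl hm hx⟩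
  · refine ⟨x, y, h, fun m _ => ⟨fun hd f hf hf' => ?_, fun hd => ?_⟩⟩
    · exact absurd hf' (Set.disjoint_left.1 hd hf)
    · exact Set.disjoint_left.2 fun f hf hf' => h (hd f hf hf' ▸ hf')

theorem sub_mem_span_of_mem_segment {o x y f : V} (h : f ∈ segment ℝ x y) :
    f - o ∈ Submodule.span ℝ {x - o, y - o} := by
  rw [segment_eq_image'] at h
  obtain ⟨s, -, rfl⟩ := h
  rw [show x + s • (y - x) - o = (1 - s) • (x - o) + s • (y - o) by module]
  exact add_mem (Submodule.smul_mem _ _ (Submodule.subset_span (by simp)))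
    (Submodule.smul_mem _ _ (Submodule.subset_span (by simp)))

theorem eq_of_mem_segments_of_notMem_span {o q x y f : V}
    (h : q - o ∉ Submodule.span ℝ {x - o, y - o}) (hf : f ∈ segment ℝ o q)
    (hf' : f ∈ segment ℝ x y) : f = o := by
  have h1 := sub_mem_span_of_mem_segment (o := o) hf'
  rw [segment_eq_image'] at hf
  obtain ⟨s, -, rfl⟩ := hf
  by_contra hs
  have hs0 : s ≠ 0 := by rintro rfl; simp at hs
  rw [add_sub_cancel_left, Submodule.smul_mem_iff _ hs0] at h1
  exact h h1

theorem strictMonoOn_dist_add_smul {a c u : V} (hu : u ≠ 0) (h : 0 ≤ inner ℝ u (c - a)) :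
    StrictMonoOn (fun s : ℝ => dist (c + s • u) a) (Ici 0) := by
  intro s hs t _ hst
  have hs : 0 ≤ s := hs
  have hu' : 0 < ‖u‖ ^ 2 := by positivity
  have e : ∀ s : ℝ, ‖c + s • u - a‖ ^ 2 =
      ‖c - a‖ ^ 2 + 2 * s * inner ℝ u (c - a) + s ^ 2 * ‖u‖ ^ 2 := by
    intro s
    rw [show c + s • u - a = (c - a) + s • u by abel, norm_add_sq_real, inner_smul_right,
      real_inner_comm, norm_smul, mul_pow, Real.norm_eq_abs, sq_abs]
    ring
  simp only [dist_eq_norm]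
  rw [← sq_lt_sq₀ (norm_nonneg _) (norm_nonneg _), e, e]
  have : s ^ 2 < t ^ 2 := by nlinarith
  nlinarith

end Segments

/-! ### Moving both joints along with the middle vertex -/

section FourLinks

open Module

variable {V : Type*} [NormedAddCommGroup V] [InnerProductSpace ℝ V] {ι : Type*}

/-- The chain `a, b, c, d, e` is simple, except that it may be closed, and it meets the segments
from `x i` to `y i` at most in its endpoints. -/
structure FourLinksSimple (x y : ι → V) (a b c d e : V) : Prop where
  ab : a ≠ b
  cb : c ≠ b
  cd : c ≠ d
  ed : e ≠ d
  ab_cb : ∀ f ∈ segment ℝ a b, f ∈ segment ℝ c b → f = b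
  cb_cd : ∀ f ∈ segment ℝ c b, f ∈ segment ℝ c d → f = c
  ed_cd : ∀ f ∈ segment ℝ e d, f ∈ segment ℝ c d → f = d
  ab_cd : Disjoint (segment ℝ a b) (segment ℝ c d)
  ed_cb : Disjoint (segment ℝ e d) (segment ℝ c b)
  ab_ed : ∀ f ∈ segment ℝ a b, f ∈ segment ℝ e d → f = a ∧ f = e
  ab_seg : ∀ i, ∀ f ∈ segment ℝ a b, f ∈ segment ℝ (x i) (y i) → f = a
  cb_seg : ∀ i, Disjoint (segment ℝ c b) (segment ℝ (x i) (y i))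
  cd_seg : ∀ i, Disjoint (segment ℝ c d) (segment ℝ (x i) (y i))
  ed_seg : ∀ i, ∀ f ∈ segment ℝ e d, f ∈ segment ℝ (x i) (y i) → f = e

theorem FourLinksSimple.symm {x y : ι → V} {a b c d e : V} (h : FourLinksSimple x y a b c d e) :
    FourLinksSimple x y e d c b a where
  ab := h.ed
  cb := h.cd
  cd := h.cb
  ed := h.ab
  ab_cb := h.ed_cd
  cb_cd f hf hf' := h.cb_cd f hf' hf
  ed_cd := h.ab_cb
  ab_cd := h.ed_cb
  ed_cb := h.ab_cd
  ab_ed f hf hf' := (h.ab_ed f hf' hf).symm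
  ab_seg := h.ed_seg
  cb_seg := h.cd_seg
  cd_seg := h.cb_seg
  ed_seg := h.ab_seg

/-- The chain `a, b, c, d, e` has a motion that keeps it simple, moves `c` straight to `q` and
moves `b` and `d` along, such that one of these two joints is straight at the end. -/
def HasStraighteningMotion (x y : ι → V) (a b c d e q : V) : Prop :=
  ∃ β δ : ℝ → V, Continuous β ∧ Continuous δ ∧ β 0 = b ∧ δ 0 = d ∧
    (∀ t ∈ Icc (0 : ℝ) 1, dist (β t) a = dist b a ∧ dist (β t) (c + t • (q - c)) = dist b c ∧
      dist (δ t) (c + t • (q - c)) = dist d c ∧ dist (δ t) e = dist d e ∧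
      FourLinksSimple x y a (β t) (c + t • (q - c)) (δ t) e) ∧
    (dist a q = dist b a + dist b c ∨ dist e q = dist d e + dist d c)

theorem HasStraighteningMotion.symm {x y : ι → V} {a b c d e q : V}
    (h : HasStraighteningMotion x y a b c d e q) : HasStraighteningMotion x y e d c b a q := by
  obtain ⟨β, δ, hβ, hδ, hβ0, hδ0, h, hend⟩ := h
  refine ⟨δ, β, hδ, hβ, hδ0, hβ0, fun t ht => ?_, hend.symm⟩
  obtain ⟨h1, h2, h3, h4, h5⟩ := h t ht
  exact ⟨h4, h3, h2, h1, h5.symm⟩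

variable [Finite ι]

/-- Each fixed segment is an obstacle twice, once for each link. Towards the link at `a` it is
replaced by means of `exists_obstacle`, since it may end at `a`. -/
theorem exists_elbow_path_of_fixed (hdim : 4 ≤ finrank ℝ V) {x y : ι → V} {a b : V} {c : ℝ → V}
    (hc : Continuous c) (ha : ∀ i, a ∈ segment ℝ (x i) (y i) →
      (x i = a ∧ y i ≠ a) ∨ (y i = a ∧ x i ≠ a))
    (hmono : StrictMonoOn (fun t => dist a (c t)) (Icc 0 1)) (hab : a ≠ b)
    (hlow : |dist b a - dist b (c 0)| < dist a (c 0))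
    (hhigh : dist a (c 1) = dist b a + dist b (c 0))
    (hcxy : ∀ t ∈ Icc (0 : ℝ) 1, ∀ i, c t ∉ segment ℝ (x i) (y i))
    (hend : ∀ i, ∀ f ∈ segment ℝ a (c 1), f ∈ segment ℝ (x i) (y i) → f = a)
    (h1 : ∀ i, ∀ f ∈ segment ℝ a b, f ∈ segment ℝ (x i) (y i) → f = a)
    (h2 : ∀ i, Disjoint (segment ℝ (c 0) b) (segment ℝ (x i) (y i))) :
    ∃ β : ℝ → V, Continuous β ∧ β 0 = b ∧ ∀ t ∈ Icc (0 : ℝ) 1,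
      dist (β t) a = dist b a ∧ dist (β t) (c t) = dist b (c 0) ∧
      (∀ i, ∀ f ∈ segment ℝ a (β t), f ∈ segment ℝ (x i) (y i) → f = a) ∧
      ∀ i, Disjoint (segment ℝ (c t) (β t)) (segment ℝ (x i) (y i)) := by
  choose X Y hX hXY using fun i => exists_obstacle (dist_pos.2 hab.symm) (ha i)
  obtain ⟨β, hβ, hβ0, h⟩ := exists_elbow_path hdim (ι := ι ⊕ ι) (p := fun _ => a) (r := c)
    (o := Sum.elim (fun _ _ => a) fun _ => c) (x := Sum.elim (fun i _ => X i) fun i _ => x i)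
    (y := Sum.elim (fun i _ => Y i) fun i _ => y i) continuous_const hc
    (by rintro (i | i) <;> simp) (by rintro (i | i) <;> exact continuous_const)
    (by rintro (i | i) <;> exact continuous_const) (dist_nonneg (x := b) (y := a))
    (dist_nonneg (x := b) (y := c 0)) hmono hlow hhigh.le
    (by rintro t ht (i | i); exacts [hX i, hcxy t ht i]) (by
      intro _ m hm hm'
      have hmem : m ∈ segment ℝ a (c 1) :=
        mem_segment_of_dist_add_dist_eq (by rw [dist_comm a m, hm, hm', hhigh])
      rintro (i | i)
      · exact (hXY i m hm).2 fun f hf => hend i f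
          ((convex_segment _ _).segment_subset (left_mem_segment ℝ _ _) hmem hf)
      · refine Set.disjoint_left.2 fun f hf hf' => ?_
        have := hend i f ((convex_segment _ _).segment_subset (right_mem_segment ℝ _ _) hmem hf) hf'
        subst this
        have h3 := dist_le_of_mem_segment hf
        change dist (c 1) f ≤ dist (c 1) m at h3
        rw [dist_comm _ f, hhigh, dist_comm _ m, hm'] at h3
        linarith [dist_pos.2 hab.symm])
    (m₀ := b) rfl rfl (by
      rintro (i | i)
      exacts [(hXY i b rfl).2 (h1 i), h2 i])
  refine ⟨β, hβ, hβ0, fun t ht => ?_⟩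
  obtain ⟨h3, h4, h5⟩ := h t ht
  exact ⟨h3, h4, fun i => (hXY i _ h3).1 (h5 (.inl i)), fun i => h5 (.inr i)⟩

/-- The arm at `a` is the first to become straight, and its joint `b` is moved first. If `a ≠ e`, it
also avoids the point `e`, because its links become obstacles for the link at `e`, which must not
contain `e`. -/
theorem hasStraighteningMotion_of_dist_eq (hdim : 4 ≤ finrank ℝ V) {x y : ι → V} {a b c d e u : V}
    (hs : FourLinksSimple x y a b c d e)
    (ha : ∀ i, a ∈ segment ℝ (x i) (y i) → (x i = a ∧ y i ≠ a) ∨ (y i = a ∧ x i ≠ a))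
    (he : ∀ i, e ∈ segment ℝ (x i) (y i) → (x i = e ∧ y i ≠ e) ∨ (y i = e ∧ x i ≠ e))
    (hquad : a = e → dist b a + dist b c ≠ dist d e + dist d c)
    (hu : u ≠ 0) (hua : 0 ≤ inner ℝ u (c - a)) (hue : 0 ≤ inner ℝ u (c - e))
    (hc : ∀ i, u ∉ Submodule.span ℝ {x i - c, y i - c})
    (hace : u ∉ Submodule.span ℝ {a - c, e - c})
    (hsega : ∀ i, c + u - a ∉ Submodule.span ℝ {x i - a, y i - a})
    (hsege : ∀ i, c + u - e ∉ Submodule.span ℝ {x i - e, y i - e})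
    (hq : dist a (c + u) = dist b a + dist b c) (hq' : dist e (c + u) ≤ dist d e + dist d c) :
    HasStraighteningMotion x y a b c d e (c + u) := by
  set p : ℝ → V := fun t => c + t • u with hp
  have hpc : Continuous p := by fun_prop
  have hp0 : p 0 = c := by simp [hp]
  have hp1 : p 1 = c + u := by simp [hp]
  have hlen : 0 < dist b a ∧ 0 < dist b c ∧ 0 < dist d c ∧ 0 < dist d e :=
    ⟨dist_pos.2 hs.ab.symm, dist_pos.2 hs.cb.symm, dist_pos.2 hs.cd.symm, dist_pos.2 hs.ed.symm⟩
  obtain ⟨l1, l2, l3, l4⟩ := hlen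
  have hmonoa : StrictMonoOn (fun t => dist a (p t)) (Icc 0 1) := by
    simp_rw [dist_comm a]
    exact (strictMonoOn_dist_add_smul hu hua).mono Icc_subset_Ici_self
  have hmonoe : StrictMonoOn (fun t => dist (p t) e) (Icc 0 1) :=
    (strictMonoOn_dist_add_smul hu hue).mono Icc_subset_Ici_self
  have h0I : (0 : ℝ) ∈ Icc (0 : ℝ) 1 := by simp
  have hlowb := abs_dist_sub_dist_lt hs.ab hs.cb hs.ab_cb
  have hlowd := abs_dist_sub_dist_lt hs.cd hs.ed fun f hf hf' => hs.ed_cd f hf' hf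
  have hlowb' : ∀ t ∈ Icc (0 : ℝ) 1, |dist b a - dist b c| < dist a (p t) := fun t ht =>
    hlowb.trans_le (by simpa [hp0] using hmonoa.monotoneOn h0I ht ht.1)
  have hlowd' : ∀ t ∈ Icc (0 : ℝ) 1, |dist d c - dist d e| < dist (p t) e := fun t ht =>
    hlowd.trans_le (by simpa [hp0] using hmonoe.monotoneOn h0I ht ht.1)
  have hpe : ∀ t ∈ Icc (0 : ℝ) 1, p t ≠ e := fun t ht =>
    dist_pos.1 ((abs_nonneg _).trans_lt (hlowd' t ht))
  have hpxy : ∀ t ∈ Icc (0 : ℝ) 1, ∀ i, p t ∉ segment ℝ (x i) (y i) := by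
    intro t _ i h
    rcases eq_or_ne t 0 with rfl | ht
    · rw [hp0] at h
      exact Set.disjoint_left.1 (hs.cb_seg i) (left_mem_segment ℝ c b) h
    · have := sub_mem_span_of_mem_segment (o := c) h
      rw [hp, add_sub_cancel_left, Submodule.smul_mem_iff _ ht] at this
      exact hc i this
  have hea : a ≠ e → e ∉ segment ℝ a (p 1) := by
    intro hne h
    rw [hp1, segment_eq_image'] at h
    obtain ⟨s, -, h⟩ := h
    have hs0 : s ≠ 0 := by rintro rfl; simp at h; exact hne h
    refine hace ((Submodule.smul_mem_iff _ hs0).1 ?_)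
    rw [show s • u = (s - 1) • (a - c) + (1 : ℝ) • (e - c) by rw [← h]; module]
    exact add_mem (Submodule.smul_mem _ _ (Submodule.subset_span (by simp)))
      (Submodule.smul_mem _ _ (Submodule.subset_span (by simp)))
  -- The points `a`, `e` and `c + u` are not collinear, so the final straight arms meet only in `c +
  -- u`.
  have hcross : a ≠ e → ∀ f ∈ segment ℝ a (p 1), f ∈ segment ℝ e (p 1) → f = p 1 := by
    intro hne f hf hf'
    rw [segment_symm, segment_eq_image', hp1] at hf hf'
    rw [hp1]
    obtain ⟨s, -, rfl⟩ := hf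
    obtain ⟨s', -, h⟩ := hf'
    have h' : (s - s') • u = s • (a - c) + (-s') • (e - c) := by
      have := sub_eq_zero.2 (add_left_cancel h)
      rw [← sub_eq_zero, ← this]; module
    have hss : s - s' = 0 := by
      by_contra hne'
      refine hace ((Submodule.smul_mem_iff _ hne').1 ?_)
      rw [h']
      exact add_mem (Submodule.smul_mem _ _ (Submodule.subset_span (by simp)))
        (Submodule.smul_mem _ _ (Submodule.subset_span (by simp)))
    obtain rfl : s = s' := sub_eq_zero.1 hss
    have h2 : s • (a - e) = 0 := by
      rw [sub_self, zero_smul] at h'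
      rw [h']; module
    rcases smul_eq_zero.1 h2 with rfl | h2
    · simp
    · exact absurd (sub_eq_zero.1 h2) hne
  -- First the joint `b` is moved, clear of `e` too.
  obtain ⟨β, hβ, hβ0, hβt⟩ := exists_elbow_path_of_fixed hdim (ι := ι ⊕ {_z : Unit // a ≠ e})
    (x := Sum.elim x fun _ => e) (y := Sum.elim y fun _ => e) (a := a) (b := b) (c := p) hpc
    (by
      rintro (i | ⟨_, hne⟩)
      · exact ha i
      · intro h; simp at h; exact absurd h hne)
    hmonoa hs.ab (by rw [hp0]; exact hlowb) (by rw [hp1, hp0]; exact hq)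
    (by
      rintro t ht (i | i)
      · exact hpxy t ht i
      · simpa using hpe t ht)
    (by
      rintro (i | ⟨_, hne⟩) f hf hf'
      · exact eq_of_mem_segments_of_notMem_span (hp1 ▸ hsega i) hf hf'
      · simp at hf'
        exact absurd (hf' ▸ hf) (hea hne))
    (by
      rintro (i | ⟨_, hne⟩) f hf hf'
      · exact hs.ab_seg i f hf hf'
      · simp at hf'
        subst hf'
        exact (hs.ab_ed f hf (left_mem_segment ℝ _ _)).1)
    (by
      rw [hp0]
      rintro (i | i)
      · exact hs.cb_seg i
      · simpa using Set.disjoint_left.1 hs.ed_cb (left_mem_segment ℝ e d))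
  rw [hp0] at hβt
  have hβa : ∀ t ∈ Icc (0 : ℝ) 1, β t ≠ a := fun t ht =>
    dist_pos.1 (by rw [(hβt t ht).1]; exact l1)
  have hβp : ∀ t ∈ Icc (0 : ℝ) 1, β t ≠ p t := fun t ht =>
    dist_pos.1 (by rw [(hβt t ht).2.1]; exact l2)
  have hβcb : ∀ t ∈ Icc (0 : ℝ) 1, ∀ f ∈ segment ℝ a (β t), f ∈ segment ℝ (p t) (β t) →
      f = β t := fun t ht f hf hf' => eq_of_mem_segments_of_abs_lt
    (by rw [(hβt t ht).1, (hβt t ht).2.1]; exact hlowb' t ht) hf hf'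
  have hpab : ∀ t ∈ Icc (0 : ℝ) 1, p t ∉ segment ℝ a (β t) := fun t ht h =>
    hβp t ht (hβcb t ht _ h (left_mem_segment ℝ _ _)).symm
  have hepb : ∀ t ∈ Icc (0 : ℝ) 1, e ∉ segment ℝ (p t) (β t) := by
    intro t ht h
    by_cases hae : a = e
    · subst hae
      exact hβa t ht (hβcb t ht _ (left_mem_segment ℝ _ _) h).symm
    · have := (hβt t ht).2.2.2 (.inr ⟨(), hae⟩)
      simp at this
      exact this h
  have heab : a ≠ e → ∀ t ∈ Icc (0 : ℝ) 1, e ∉ segment ℝ a (β t) := by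
    intro hae t ht h
    have := (hβt t ht).2.2.1 (.inr ⟨(), hae⟩) e h
    simp at this
    exact hae this.symm
  -- Obstacles for the link at `e`, and those for the link at `c` which end there.
  choose X Y hX hXY using fun i => exists_obstacle l4 (he i)
  -- If `a = e`, the links `a b` and `e d` share this endpoint, and the obstacle is the point of the
  -- ray towards `β t` at distance `dist d e`. Otherwise it is the link `a b` itself.
  obtain ⟨X', Y', hX'c, hY'c, hX'⟩ : ∃ X' Y' : ℝ → V, Continuous X' ∧ Continuous Y' ∧
      ∀ t ∈ Icc (0 : ℝ) 1, e ∉ segment ℝ (X' t) (Y' t) ∧ ∀ m, dist m e = dist d e →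
        (Disjoint (segment ℝ e m) (segment ℝ (X' t) (Y' t)) ↔
          ∀ f ∈ segment ℝ a (β t), f ∈ segment ℝ e m → f = a ∧ f = e) := by
    by_cases hae : a = e
    · subst hae
      have hcont : Continuous fun t => a + (dist d a / dist b a) • (β t - a) := by fun_prop
      refine ⟨_, _, hcont, hcont, fun t ht => ?_⟩
      rw [← (hβt t ht).1]
      refine ⟨notMem_singleton_ray l4 (hβa t ht), fun m hm => ?_⟩
      rw [disjoint_singleton_ray_iff l4 hm (hβa t ht)]
      exact ⟨fun h f hf hf' => ⟨h f hf' hf, h f hf' hf⟩, fun h f hf hf' => (h f hf' hf).1⟩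
    · refine ⟨fun _ => a, β, continuous_const, hβ, fun t ht => ⟨heab hae t ht, fun m _ => ?_⟩⟩
      refine ⟨fun h f hf hf' => (Set.disjoint_left.1 h hf' hf).elim, fun h => ?_⟩
      refine Set.disjoint_left.2 fun f hf hf' => hae ?_
      have := h f hf' hf
      exact this.1.symm.trans this.2
  -- The links at `c` overlap exactly if `c d` ends at or runs through this point of the ray towards
  -- `β t`. The constant `dist b c` in place of `dist (β t) (p t)` makes it continuous at all times.
  obtain ⟨Z, hZc, hZ⟩ : ∃ Z : ℝ → V, Continuous Z ∧ ∀ t ∈ Icc (0 : ℝ) 1,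
      Z t = p t + (dist d c / dist (β t) (p t)) • (β t - p t) :=
    ⟨fun t => p t + (dist d c / dist b c) • (β t - p t), by fun_prop,
      fun t ht => by simp only [(hβt t ht).2.1]⟩
  obtain ⟨δ, hδ, hδ0, hδt⟩ := exists_elbow_path hdim (ι := (ι ⊕ ι) ⊕ ((Unit ⊕ Unit) ⊕ (Unit ⊕ Unit)))
    (p := p) (r := fun _ => e)
    (o := Sum.elim (Sum.elim (fun _ _ => e) fun _ => p)
      (Sum.elim (fun _ => p) (fun _ _ => e)))
    (x := Sum.elim (Sum.elim (fun i _ => X i) fun i _ => x i)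
      (Sum.elim (Sum.elim (fun _ _ => a) fun _ => Z)
        (Sum.elim (fun _ => p) fun _ => X')))
    (y := Sum.elim (Sum.elim (fun i _ => Y i) fun i _ => y i)
      (Sum.elim (Sum.elim (fun _ => β) fun _ => Z)
        (Sum.elim (fun _ => β) fun _ => Y')))
    hpc continuous_const (by rintro ((i | i) | (i | i)) <;> simp)
    (by
      rintro ((i | i) | ((i | i) | (i | i)))
      exacts [continuous_const, continuous_const, continuous_const, hZc, hpc, hX'c])
    (by
      rintro ((i | i) | ((i | i) | (i | i)))
      exacts [continuous_const, continuous_const, hβ, hZc, hβ, hY'c])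
    l3.le l4.le hmonoe (by rw [hp0]; exact hlowd)
    (by rw [hp1, dist_comm]; linarith)
    (by
      rintro t ht ((i | i) | ((i | i) | (i | i)))
      · exact hX i
      · exact hpxy t ht i
      · exact hpab t ht
      · change p t ∉ segment ℝ (Z t) (Z t)
        rw [hZ t ht]
        exact notMem_singleton_ray l3 (hβp t ht)
      · exact hepb t ht
      · exact (hX' t ht).1)
    (by
      intro hd m hm hm'
      have h1I : (1 : ℝ) ∈ Icc (0 : ℝ) 1 := by simp
      -- Both arms are straight now. With `a = e` they would cover the same segment and have equal
      -- total lengths, the excluded quadrilateral.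
      have hae : a ≠ e := by
        intro hae
        refine hquad hae ?_
        rw [← hq, ← hp1, hae, dist_comm, hd, add_comm]
      have hmem : m ∈ segment ℝ e (p 1) :=
        mem_segment_of_dist_add_dist_eq (by
          rw [dist_comm e m, hm, hm', dist_comm e, hd, add_comm])
      have hbmem : β 1 ∈ segment ℝ a (p 1) :=
        mem_segment_of_dist_add_dist_eq (by
          rw [dist_comm a, (hβt 1 h1I).1, (hβt 1 h1I).2.1, hp1, hq])
      have sub1 := (convex_segment e (p 1)).segment_subset (left_mem_segment ℝ _ _) hmem
      have sub2 := (convex_segment e (p 1)).segment_subset (right_mem_segment ℝ _ _) hmem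
      have sub3 := (convex_segment a (p 1)).segment_subset (left_mem_segment ℝ _ _) hbmem
      have sub4 := (convex_segment a (p 1)).segment_subset (right_mem_segment ℝ _ _) hbmem
      have hpem : p 1 ∉ segment ℝ e m := by
        intro h
        have h := dist_le_of_mem_segment h
        rw [dist_comm e, hd, dist_comm e, hm'] at h
        linarith
      have hemp : e ∉ segment ℝ (p 1) m := by
        intro h
        have h := dist_le_of_mem_segment h
        rw [hd, dist_comm _ m, hm] at h
        linarith
      have hfe : ∀ i, ∀ f ∈ segment ℝ e (p 1), f ∈ segment ℝ (x i) (y i) → f = e :=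
        fun i f hf hf' => eq_of_mem_segments_of_notMem_span (hp1 ▸ hsege i) hf hf'
      rintro ((i | i) | ((i | i) | (i | i)))
      · exact (hXY i m hm').2 fun f hf => hfe i f (sub1 hf)
      · exact Set.disjoint_left.2 fun f hf hf' => hemp (hfe i f (sub2 hf) hf' ▸ hf)
      · exact Set.disjoint_left.2 fun f hf hf' =>
          hpab 1 h1I (hcross hae f (sub3 hf') (sub2 hf) ▸ hf')
      · change Disjoint (segment ℝ (p 1) m) (segment ℝ (Z 1) (Z 1))
        rw [hZ 1 h1I]
        exact (disjoint_singleton_ray_iff l3 hm (hβp 1 h1I)).2 fun f hf hf' =>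
          hcross hae f (sub4 hf') (sub2 hf)
      · exact Set.disjoint_left.2 fun f hf hf' =>
          hpem (hcross hae f (sub4 hf') (sub1 hf) ▸ hf)
      · exact ((hX' 1 h1I).2 m hm').2 fun f hf hf' =>
          absurd (hcross hae f (sub3 hf) (sub1 hf') ▸ hf') hpem)
    (m₀ := d) (by rw [hp0]) rfl
    (by
      rintro ((i | i) | ((i | i) | (i | i)))
      · exact (hXY i d rfl).2 (hs.ed_seg i)
      · change Disjoint (segment ℝ (p 0) d) _
        rw [hp0]
        exact hs.cd_seg i
      · change Disjoint (segment ℝ (p 0) d) (segment ℝ a (β 0))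
        rw [hp0, hβ0]
        exact hs.ab_cd.symm
      · change Disjoint (segment ℝ (p 0) d) (segment ℝ (Z 0) (Z 0))
        rw [hZ 0 h0I, hp0, hβ0]
        exact (disjoint_singleton_ray_iff l3 rfl hs.cb.symm).2 fun f hf hf' => hs.cb_cd f hf' hf
      · change Disjoint (segment ℝ e d) (segment ℝ (p 0) (β 0))
        rw [hp0, hβ0]
        exact hs.ed_cb
      · exact ((hX' 0 h0I).2 d rfl).2 (by rw [hβ0]; exact hs.ab_ed))
  refine ⟨β, δ, hβ, hδ, hβ0, hδ0, fun t ht => ?_, .inl hq⟩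
  rw [add_sub_cancel_left]
  change _ ∧ dist _ (p t) = _ ∧ dist _ (p t) = _ ∧ _ ∧ FourLinksSimple x y a (β t) (p t) (δ t) e
  obtain ⟨b1, b2, b3, b4⟩ := hβt t ht
  obtain ⟨d1, d2, d3⟩ := hδt t ht
  refine ⟨b1, b2, d1, d2, ?_⟩
  have o1 := fun i => d3 (.inl (.inl i))
  have o2 := fun i => d3 (.inl (.inr i))
  have o3 : Disjoint (segment ℝ (p t) (δ t)) (segment ℝ a (β t)) := d3 (.inr (.inl (.inl ())))
  have o4 : Disjoint (segment ℝ (p t) (δ t))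
    (segment ℝ (Z t) (Z t)) := d3 (.inr (.inl (.inr ())))
  have o5 : Disjoint (segment ℝ e (δ t)) (segment ℝ (p t) (β t)) := d3 (.inr (.inr (.inl ())))
  have o6 : Disjoint (segment ℝ e (δ t)) (segment ℝ (X' t) (Y' t)) := d3 (.inr (.inr (.inr ())))
  rw [hZ t ht, disjoint_singleton_ray_iff l3 d1 (hβp t ht)] at o4
  exact {
    ab := (hβa t ht).symm
    cb := (hβp t ht).symm
    cd := (dist_pos.1 (by rw [d1]; exact l3)).symm
    ed := (dist_pos.1 (by rw [d2]; exact l4)).symm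
    ab_cb := hβcb t ht
    cb_cd := fun f hf hf' => o4 f hf' hf
    ed_cd := fun f hf hf' => eq_of_mem_segments_of_abs_lt
      (by rw [d1, d2]; exact hlowd' t ht) hf' hf
    ab_cd := o3.symm
    ed_cb := o5
    ab_ed := ((hX' t ht).2 _ d2).1 o6
    ab_seg := fun i => b3 (.inl i)
    cb_seg := fun i => b4 (.inl i)
    cd_seg := o2
    ed_seg := fun i => (hXY i _ d2).1 (o1 i) }

end FourLinks

/-! ### Choice of the ray -/

section Direction

open Module

variable {V : Type*} [NormedAddCommGroup V] [InnerProductSpace ℝ V]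

/-- In dimension at least four, some direction makes no obtuse angle with either of two vectors and
avoids finitely many planes and three-dimensional subspaces through one of the vectors. -/
theorem exists_direction (hdim : 4 ≤ finrank ℝ V) {p q : V} (hp : p ≠ 0) (hq : q ≠ 0)
    {S : Set (Submodule ℝ V)} (hS : S.Finite)
    (h : ∀ L ∈ S, finrank ℝ L ≤ 2 ∨ finrank ℝ L ≤ 3 ∧ (p ∈ L ∨ q ∈ L)) :
    ∃ u : V, u ≠ 0 ∧ 0 ≤ inner ℝ u p ∧ 0 ≤ inner ℝ u q ∧ ∀ L ∈ S, u ∉ L := by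
  have : FiniteDimensional ℝ V := Module.finite_of_finrank_pos (by lia)
  have hp' : 0 < ‖p‖ := norm_pos_iff.2 hp
  have hq' : 0 < ‖q‖ := norm_pos_iff.2 hq
  -- Vectors orthogonal to `z` make equal angles with `p` and `q`, so one of `u` and `-u` has both
  -- products nonnegative.
  set z := ‖p‖⁻¹ • p - ‖q‖⁻¹ • q with hz
  have hzp : ‖z‖ ^ 2 = 2 * ‖p‖⁻¹ * inner ℝ z p := by
    rw [hz, norm_sub_sq_real, inner_sub_left, norm_smul, norm_smul, inner_smul_left,
      inner_smul_left, inner_smul_left, inner_smul_right, real_inner_self_eq_norm_sq,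
      real_inner_comm p q]
    simp only [norm_inv, norm_norm, conj_trivial]
    field_simp
    ring
  have hzq : ‖z‖ ^ 2 = -2 * ‖q‖⁻¹ * inner ℝ z q := by
    rw [hz, norm_sub_sq_real, inner_sub_left, norm_smul, norm_smul, inner_smul_left,
      inner_smul_left, inner_smul_left, inner_smul_right, real_inner_self_eq_norm_sq]
    simp only [norm_inv, norm_norm, conj_trivial]
    field_simp
    ring
  have hH := Submodule.finrank_add_finrank_orthogonal (Submodule.span ℝ {z})
  obtain ⟨u, huH, hu⟩ := Submodule.exists_mem_forall_notMem_of_finite (Submodule.span ℝ {z})ᗮ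
    (hS.insert ⊥) (by
      have hspan : finrank ℝ (Submodule.span ℝ {z}) ≤ 1 := by
        have := finrank_span_finset_le_card (R := ℝ) ({z} : Finset V)
        rwa [Set.finrank, Finset.coe_singleton, Finset.card_singleton] at this
      rintro L (rfl | hL) hle
      · have := Submodule.finrank_mono hle
        rw [finrank_bot] at this
        lia
      · have hle' := Submodule.finrank_mono hle
        rcases h L hL with h2 | ⟨h3, hpq⟩
        · lia
        -- A three-dimensional `L` containing the orthogonal complement of `z` would equal it. Then
        -- `p` or `q` is orthogonal to `z`, which forces `z = 0`, and the complement is the whole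
        -- space.
        have heq := Submodule.eq_of_le_of_finrank_le hle (by lia)
        have hz0 : z = 0 := by
          rw [← norm_eq_zero, ← sq_eq_zero_iff]
          rcases hpq with hpL | hqL
          · rw [← heq, Submodule.mem_orthogonal_singleton_iff_inner_right] at hpL
            rw [hzp, hpL, mul_zero]
          · rw [← heq, Submodule.mem_orthogonal_singleton_iff_inner_right] at hqL
            rw [hzq, hqL, mul_zero]
        rw [hz0, Submodule.span_zero_singleton, finrank_bot] at hH
        rw [hz0, Submodule.span_zero_singleton] at hle'
        lia)
  have hu0 : u ≠ 0 := fun h => hu ⊥ (.inl rfl) (by simp [h])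
  rw [Submodule.mem_orthogonal_singleton_iff_inner_left, hz, inner_sub_right, inner_smul_right,
    inner_smul_right, sub_eq_zero] at huH
  have hup : inner ℝ u q = ‖q‖ * ‖p‖⁻¹ * inner ℝ u p := by
    rw [mul_assoc, huH]; field_simp
  have hc : 0 < ‖q‖ * ‖p‖⁻¹ := by positivity
  rcases le_total 0 (inner ℝ u p) with h0 | h0
  · exact ⟨u, hu0, h0, by rw [hup]; positivity, fun L hL => hu L (.inr hL)⟩
  · refine ⟨-u, neg_ne_zero.2 hu0, by rw [inner_neg_left]; linarith, ?_,
      fun L hL h => hu L (.inr hL) (by simpa using h)⟩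
    rw [inner_neg_left, hup]
    nlinarith

theorem exists_pos_dist_add_smul_eq {a c u : V} (hu : u ≠ 0) {R : ℝ} (h : dist a c < R) :
    ∃ s : ℝ, 0 < s ∧ dist a (c + s • u) = R := by
  have hu' : 0 < ‖u‖ := norm_pos_iff.2 hu
  have hR : 0 < R := dist_nonneg.trans_lt h
  set T := (R + dist a c) / ‖u‖ with hT
  have hT0 : 0 ≤ T := by positivity
  have hf : Continuous fun s : ℝ => dist a (c + s • u) := by fun_prop
  have hT1 : R ≤ dist a (c + T • u) := by
    have h1 := dist_triangle c a (c + T • u)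
    rw [dist_self_add_right, norm_smul, Real.norm_of_nonneg hT0, hT,
      div_mul_cancel₀ _ hu'.ne', dist_comm c a] at h1
    linarith
  obtain ⟨s, hs, hs'⟩ := intermediate_value_Icc hT0 hf.continuousOn
    ⟨by simpa using h.le, hT1⟩
  refine ⟨s, hs.1.lt_of_ne ?_, hs'⟩
  rintro rfl
  simp only [zero_smul, add_zero] at hs'
  exact h.ne hs'

variable {ι : Type*} [Finite ι]

/-- The direction is fixed before the distance to travel, which is the smaller of the two that
straighten an arm. Genericity must therefore hold for every multiple of `u`; this is why the spans
that protect the final arms include `c - a` or `c - e`. -/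
theorem exists_hasStraighteningMotion (hdim : 4 ≤ finrank ℝ V) {x y : ι → V} {a b c d e : V}
    (hs : FourLinksSimple x y a b c d e)
    (ha : ∀ i, a ∈ segment ℝ (x i) (y i) → (x i = a ∧ y i ≠ a) ∨ (y i = a ∧ x i ≠ a))
    (he : ∀ i, e ∈ segment ℝ (x i) (y i) → (x i = e ∧ y i ≠ e) ∨ (y i = e ∧ x i ≠ e))
    (hb : dist a c < dist b a + dist b c) (hd : dist e c < dist d e + dist d c)
    (hquad : a = e → dist b a + dist b c ≠ dist d e + dist d c) :
    ∃ u : V, u ≠ 0 ∧ 0 ≤ inner ℝ u (c - a) ∧ 0 ≤ inner ℝ u (c - e) ∧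
      HasStraighteningMotion x y a b c d e (c + u) := by
  have hca : c - a ≠ 0 := sub_ne_zero.2 (dist_pos.1
    ((abs_nonneg _).trans_lt (abs_dist_sub_dist_lt hs.ab hs.cb hs.ab_cb))).symm
  have hce : c - e ≠ 0 := sub_ne_zero.2 (dist_pos.1
    ((abs_nonneg _).trans_lt (abs_dist_sub_dist_lt hs.ed hs.cd hs.ed_cd))).symm
  obtain ⟨u, hu, hua, hue, huS⟩ := exists_direction hdim hca hce
    (S := insert (Submodule.span ℝ {a - c, e - c})
      ((range fun i => Submodule.span ℝ {x i - c, y i - c}) ∪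
        ((range fun i => Submodule.span ℝ {c - a, x i - a, y i - a}) ∪
          range fun i => Submodule.span ℝ {c - e, x i - e, y i - e})))
    (((finite_range _).union ((finite_range _).union (finite_range _))).insert _) (by
      rintro _ (rfl | ⟨i, rfl⟩ | ⟨i, rfl⟩ | ⟨i, rfl⟩)
      · exact .inl (finrank_span_pair_le _ _)
      · exact .inl (finrank_span_pair_le _ _)
      · exact .inr ⟨finrank_span_triple_le _ _ _, .inl (Submodule.subset_span (by simp))⟩
      · exact .inr ⟨finrank_span_triple_le _ _ _, .inr (Submodule.subset_span (by simp))⟩)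
  have hace := huS _ (.inl rfl)
  have hc := fun i => huS _ (.inr (.inl ⟨i, rfl⟩))
  have hside : ∀ o : V, ∀ i, u ∉ Submodule.span ℝ {c - o, x i - o, y i - o} → ∀ s : ℝ, s ≠ 0 →
      c + s • u - o ∉ Submodule.span ℝ {x i - o, y i - o} := by
    intro o i h s hs0 hmem
    refine h ((Submodule.smul_mem_iff _ hs0).1 ?_)
    rw [show s • u = (c + s • u - o) - (c - o) by abel]
    exact sub_mem (Submodule.span_mono (by simp) hmem) (Submodule.subset_span (by simp))
  have hsega := fun i => hside a i (huS _ (.inr (.inr (.inl ⟨i, rfl⟩))))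
  have hsege := fun i => hside e i (huS _ (.inr (.inr (.inr ⟨i, rfl⟩))))
  obtain ⟨s, hs0, hsa⟩ := exists_pos_dist_add_smul_eq hu hb
  obtain ⟨s', hs0', hse⟩ := exists_pos_dist_add_smul_eq hu hd
  have hinner : ∀ s : ℝ, 0 < s → ∀ o : V, 0 ≤ inner ℝ u (c - o) → 0 ≤ inner ℝ (s • u) (c - o) := by
    intro s hs o ho
    rw [inner_smul_left]
    exact mul_nonneg hs.le ho
  have hsmul : ∀ s : ℝ, 0 < s → ∀ L : Submodule ℝ V, u ∉ L → s • u ∉ L := fun s hs L hL h =>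
    hL ((Submodule.smul_mem_iff _ hs.ne').1 h)
  have hmono : ∀ o, 0 ≤ inner ℝ u (c - o) → ∀ s : ℝ, 0 < s → ∀ s' : ℝ, 0 < s' → s ≤ s' →
      dist o (c + s • u) ≤ dist o (c + s' • u) := by
    intro o ho s hs s' hs' hle
    rw [dist_comm o, dist_comm o]
    exact (strictMonoOn_dist_add_smul hu ho).monotoneOn (mem_Ici.2 hs.le) (mem_Ici.2 hs'.le) hle
  rcases le_total s s' with hle | hle
  · exact ⟨s • u, smul_ne_zero hs0.ne' hu, hinner s hs0 a hua, hinner s hs0 e hue,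
      hasStraighteningMotion_of_dist_eq hdim hs ha he hquad (smul_ne_zero hs0.ne' hu)
        (hinner s hs0 a hua) (hinner s hs0 e hue) (fun i => hsmul s hs0 _ (hc i))
        (hsmul s hs0 _ hace) (fun i => hsega i s hs0.ne') (fun i => hsege i s hs0.ne') hsa
        ((hmono e hue s hs0 s' hs0' hle).trans hse.le)⟩
  · exact ⟨s' • u, smul_ne_zero hs0'.ne' hu, hinner s' hs0' a hua, hinner s' hs0' e hue,
      (hasStraighteningMotion_of_dist_eq hdim hs.symm he ha (fun h => (hquad h.symm).symm)
        (smul_ne_zero hs0'.ne' hu) (hinner s' hs0' e hue) (hinner s' hs0' a hua)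
        (fun i => hsmul s' hs0' _ (hc i)) (by rw [Set.pair_comm]; exact hsmul s' hs0' _ hace)
        (fun i => hsege i s' hs0'.ne') (fun i => hsega i s' hs0'.ne') hse
        ((hmono a hua s' hs0' s hs0 hle).trans hsa.le)).symm⟩

theorem angle_eq_pi_iff_dist_eq {a b c : V} (hab : a ≠ b) (hcb : c ≠ b) :
    EuclideanGeometry.angle a b c = Real.pi ↔ dist a c = dist b a + dist b c := by
  rw [EuclideanGeometry.angle_eq_pi_iff_sbtw, dist_comm b a, eq_comm, dist_add_dist_eq_iff]
  exact ⟨fun h => h.wbtw, fun h => ⟨h, hab.symm, hcb.symm⟩⟩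

end Direction

/-! ### From chains to four links and back -/

namespace PolygonalChain

theorem isSimple_iff {n : ℕ} {v : ℕ → E4} : IsSimple n v ↔ (∀ i, i < n → v i ≠ v (i + 1)) ∧
    ∀ i j, i < j → j < n → ∀ f ∈ link v i, f ∈ link v j →
      (j = i + 1 ∧ f = v j) ∨ (i + 1 < j ∧ i = 0 ∧ j + 1 = n ∧ v n = v 0 ∧ f = v 0) := by
  constructor
  · refine fun h => ⟨h.ne, fun i j hij hj f hf hf' => ?_⟩
    rcases (Nat.succ_le_of_lt hij).eq_or_lt with rfl | hlt
    · have : f ∈ link v i ∩ link v (i + 1) := ⟨hf, hf'⟩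
      rw [h.consecutive i hj] at this
      exact .inl ⟨rfl, this⟩
    · have hmem : f ∈ link v i ∩ link v j := ⟨hf, hf'⟩
      by_cases hc : i = 0 ∧ j + 1 = n ∧ v n = v 0
      · rw [h.closing i j hlt hj hc] at hmem
        exact .inr ⟨hlt, hc.1, hc.2.1, hc.2.2, hmem⟩
      · rw [h.nonadjacent i j hlt hj hc] at hmem
        exact hmem.elim
  · rintro ⟨hne, h⟩
    refine ⟨hne, fun i hi => ?_, fun i j hij hj hc => ?_, fun i j hij hj hc => ?_⟩
    · refine Set.Subset.antisymm (fun f hf => ?_) ?_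
      · rcases h i (i + 1) (by lia) hi f hf.1 hf.2 with h | h
        · exact h.2
        · lia
      · rintro _ rfl
        exact ⟨right_mem_segment ℝ _ _, left_mem_segment ℝ _ _⟩
    · refine Set.Subset.antisymm (fun f hf => ?_) ?_
      · rcases h i j (by lia) hj f hf.1 hf.2 with h | h
        · lia
        · exact h.2.2.2.2
      · obtain ⟨rfl, rfl, h0⟩ := hc
        rintro _ rfl
        exact ⟨left_mem_segment ℝ _ _, h0 ▸ right_mem_segment ℝ _ _⟩
    · refine Set.eq_empty_of_forall_notMem fun f hf => ?_
      rcases h i j (by lia) hj f hf.1 hf.2 with h | h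
      · lia
      · exact hc ⟨h.2.1, h.2.2.1, h.2.2.2.1⟩

/-- The links of a chain with `n` links other than the four consecutive ones from link `k` on. -/
abbrev OtherLink (n k : ℕ) : Type := {i : Fin n // (i : ℕ) < k ∨ k + 3 < i}

variable {n k : ℕ} {v w : ℕ → E4}

theorem IsSimple.fourLinksSimple (hk : k + 4 ≤ n) (hv : IsSimple n v) :
    FourLinksSimple (fun i : OtherLink n k => v i.1) (fun i => v (i.1 + 1))
      (v k) (v (k + 1)) (v (k + 2)) (v (k + 3)) (v (k + 4)) := by
  obtain ⟨hne, h⟩ := isSimple_iff.1 hv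
  have m1 : ∀ f, f ∈ segment ℝ (v (k + 2)) (v (k + 1)) → f ∈ link v (k + 1) := fun f hf => by
    rw [segment_symm] at hf; exact hf
  have m3 : ∀ f, f ∈ segment ℝ (v (k + 4)) (v (k + 3)) → f ∈ link v (k + 3) := fun f hf => by
    rw [segment_symm] at hf; exact hf
  refine ⟨hne k (by lia), (hne (k + 1) (by lia)).symm, hne (k + 2) (by lia),
    (hne (k + 3) (by lia)).symm, fun f hf hf' => ?_, fun f hf hf' => ?_, fun f hf hf' => ?_,
    Set.disjoint_left.2 fun f hf hf' => ?_, Set.disjoint_left.2 fun f hf hf' => ?_,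
    fun f hf hf' => ?_, ?_, ?_, ?_, ?_⟩
  · rcases h k (k + 1) (by lia) (by lia) f hf (m1 f hf') with h | h
    exacts [h.2, by lia]
  · rcases h (k + 1) (k + 2) (by lia) (by lia) f (m1 f hf) hf' with h | h
    exacts [h.2, by lia]
  · rcases h (k + 2) (k + 3) (by lia) (by lia) f hf' (m3 f hf) with h | h
    exacts [h.2, by lia]
  · rcases h k (k + 2) (by lia) (by lia) f hf hf' with h | h <;> lia
  · rcases h (k + 1) (k + 3) (by lia) (by lia) f (m1 f hf') (m3 f hf) with h | h <;> lia
  · rcases h k (k + 3) (by lia) (by lia) f hf (m3 f hf') with h | ⟨-, rfl, rfl, h, h'⟩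
    exacts [by lia, ⟨h', h'.trans h.symm⟩]
  · rintro ⟨⟨i, hi⟩, hik | hik⟩ f hf hf'
    · rcases h i k hik (by lia) f hf' hf with h | h
      exacts [h.2, by lia]
    · rcases h k i (by simp at hik; lia) hi f hf hf' with h | ⟨-, rfl, -, -, h⟩
      exacts [by simp at hik; lia, h]
  · rintro ⟨⟨i, hi⟩, hik | hik⟩ <;> refine Set.disjoint_left.2 fun f hf hf' => ?_ <;>
      simp only at hik
    · rcases h i (k + 1) (by lia) (by lia) f hf' (m1 f hf) with h | h <;> lia
    · rcases h (k + 1) i (by lia) hi f (m1 f hf) hf' with h | h <;> lia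
  · rintro ⟨⟨i, hi⟩, hik | hik⟩ <;> refine Set.disjoint_left.2 fun f hf hf' => ?_ <;>
      simp only at hik
    · rcases h i (k + 2) (by lia) (by lia) f hf' hf with h | h <;> lia
    · rcases h (k + 2) i (by lia) hi f hf hf' with h | h <;> lia
  · rintro ⟨⟨i, hi⟩, hik | hik⟩ f hf hf' <;> simp only at hik
    · rcases h i (k + 3) (by lia) (by lia) f hf' (m3 f hf) with h | ⟨-, -, h, h', h''⟩
      exacts [by lia, by rw [h'', ← h', ← h]]
    · rcases h (k + 3) i (by lia) hi f (m3 f hf) hf' with ⟨rfl, h⟩ | h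
      exacts [h, by lia]

/-- Such a link is the one before `v k`, or the last link of a closed chain if `k = 0`. This is what
`exists_obstacle` needs. -/
theorem IsSimple.mem_otherLink_left (hk : k + 4 ≤ n) (hv : IsSimple n v) (i : OtherLink n k)
    (h : v k ∈ segment ℝ (v i.1) (v (i.1 + 1))) :
    (v i.1 = v k ∧ v (i.1 + 1) ≠ v k) ∨ (v (i.1 + 1) = v k ∧ v i.1 ≠ v k) := by
  obtain ⟨hne, hd⟩ := isSimple_iff.1 hv
  obtain ⟨⟨i, hi⟩, hik | hik⟩ := i <;> simp only at hik h ⊢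
  · rcases hd i k hik (by lia) _ h (left_mem_segment ℝ _ _) with ⟨rfl, -⟩ | h
    exacts [.inr ⟨rfl, hne i hi⟩, by lia]
  · rcases hd k i (by lia) hi _ (left_mem_segment ℝ _ _) h with h | ⟨-, rfl, rfl, h, -⟩
    exacts [by lia, .inr ⟨h, h ▸ hne i hi⟩]

theorem IsSimple.mem_otherLink_right (hk : k + 4 ≤ n) (hv : IsSimple n v) (i : OtherLink n k)
    (h : v (k + 4) ∈ segment ℝ (v i.1) (v (i.1 + 1))) :
    (v i.1 = v (k + 4) ∧ v (i.1 + 1) ≠ v (k + 4)) ∨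
      (v (i.1 + 1) = v (k + 4) ∧ v i.1 ≠ v (k + 4)) := by
  obtain ⟨hne, hd⟩ := isSimple_iff.1 hv
  obtain ⟨⟨i, hi⟩, hik | hik⟩ := i <;> simp only at hik h ⊢
  · rcases hd i (k + 3) (by lia) (by lia) _ h (right_mem_segment ℝ _ _) with
      h | ⟨-, rfl, rfl, h, -⟩
    exacts [by lia, .inl ⟨h.symm, h ▸ (hne 0 hi).symm⟩]
  · rcases hd (k + 3) i (by lia) hi _ (right_mem_segment ℝ _ _) h with ⟨rfl, -⟩ | h
    exacts [.inl ⟨rfl, (hne _ hi).symm⟩, by lia]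

/-- A chain that differs from a simple one in four consecutive links only is simple if these four
links are as in a simple chain. -/
theorem IsSimple.of_fourLinksSimple (hk : k + 4 ≤ n) (hv : IsSimple n v)
    (hw : ∀ i, i ≠ k + 1 → i ≠ k + 2 → i ≠ k + 3 → w i = v i)
    (hs : FourLinksSimple (fun i : OtherLink n k => v i.1) (fun i => v (i.1 + 1))
      (v k) (w (k + 1)) (w (k + 2)) (w (k + 3)) (v (k + 4))) : IsSimple n w := by
  obtain ⟨hne, hd⟩ := isSimple_iff.1 hv
  have hwk : w k = v k := hw k (by lia) (by lia) (by lia)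
  have hwk4 : w (k + 4) = v (k + 4) := hw _ (by lia) (by lia) (by lia)
  have hw0 : w 0 = v 0 := hw 0 (by lia) (by lia) (by lia)
  have hwn : w n = v n := hw n (by lia) (by lia) (by lia)
  have hlink : ∀ i, i < k ∨ k + 3 < i → link w i = link v i := fun i hi => by
    rw [link, link, hw i (by lia) (by lia) (by lia), hw (i + 1) (by lia) (by lia) (by lia)]
  have m0 : ∀ f ∈ link w k, f ∈ segment ℝ (v k) (w (k + 1)) := fun f hf => by
    rw [link, hwk] at hf; exact hf
  have m1 : ∀ f ∈ link w (k + 1), f ∈ segment ℝ (w (k + 2)) (w (k + 1)) := fun f hf => by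
    rw [segment_symm]; exact hf
  have m3 : ∀ f ∈ link w (k + 3), f ∈ segment ℝ (v (k + 4)) (w (k + 3)) := fun f hf => by
    rw [segment_symm, ← hwk4]; exact hf
  refine isSimple_iff.2 ⟨fun i hi => ?_, fun i j hij hj f hf hf' => ?_⟩
  · obtain rfl | rfl | rfl | rfl | h : i = k ∨ i = k + 1 ∨ i = k + 2 ∨ i = k + 3 ∨
      (i < k ∨ k + 3 < i) := by lia
    · rw [hwk]; exact hs.ab
    · exact hs.cb.symm
    · exact hs.cd
    · rw [hwk4]; exact hs.ed.symm
    · rw [hw i (by lia) (by lia) (by lia), hw (i + 1) (by lia) (by lia) (by lia)]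
      exact hne i hi
  rw [hwn, hw0]
  obtain rfl | rfl | rfl | rfl | hi : i = k ∨ i = k + 1 ∨ i = k + 2 ∨ i = k + 3 ∨
      (i < k ∨ k + 3 < i) := by lia
  · obtain rfl | rfl | rfl | hj' : j = i + 1 ∨ j = i + 2 ∨ j = i + 3 ∨ i + 3 < j := by lia
    · exact .inl ⟨rfl, hs.ab_cb f (m0 f hf) (m1 f hf')⟩
    · exact (Set.disjoint_left.1 hs.ab_cd (m0 f hf) hf').elim
    · obtain ⟨h1, h2⟩ := hs.ab_ed f (m0 f hf) (m3 f hf')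
      subst h1
      rcases hd i (i + 3) hij hj _ (left_mem_segment ℝ _ _) (h2 ▸ right_mem_segment ℝ _ _) with
        h | h
      exacts [by lia, .inr h]
    · rw [hlink j (.inr hj')] at hf'
      have h1 := hs.ab_seg ⟨⟨j, hj⟩, .inr hj'⟩ f (m0 f hf) hf'
      subst h1
      rcases hd i j hij hj _ (left_mem_segment ℝ _ _) hf' with h | h
      exacts [by lia, .inr h]
  · obtain rfl | rfl | hj' : j = k + 2 ∨ j = k + 3 ∨ k + 3 < j := by lia
    · exact .inl ⟨rfl, hs.cb_cd f (m1 f hf) hf'⟩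
    · exact (Set.disjoint_left.1 hs.ed_cb (m3 f hf') (m1 f hf)).elim
    · rw [hlink j (.inr hj')] at hf'
      exact (Set.disjoint_left.1 (hs.cb_seg ⟨⟨j, hj⟩, .inr hj'⟩) (m1 f hf) hf').elim
  · obtain rfl | hj' : j = k + 3 ∨ k + 3 < j := by lia
    · exact .inl ⟨rfl, hs.ed_cd f (m3 f hf') hf⟩
    · rw [hlink j (.inr hj')] at hf'
      exact (Set.disjoint_left.1 (hs.cd_seg ⟨⟨j, hj⟩, .inr hj'⟩) hf hf').elim
  · rw [hlink j (.inr hij)] at hf'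
    have h1 := hs.ed_seg ⟨⟨j, hj⟩, .inr hij⟩ f (m3 f hf) hf'
    subst h1
    rcases hd (k + 3) j hij hj _ (right_mem_segment ℝ _ _) hf' with ⟨rfl, -⟩ | h
    exacts [.inl ⟨rfl, hwk4.symm⟩, .inr h]
  · rw [hlink i hi] at hf
    obtain rfl | rfl | rfl | rfl | hj' : j = k ∨ j = k + 1 ∨ j = k + 2 ∨ j = k + 3 ∨
      (j < k ∨ k + 3 < j) := by lia
    · have h1 := hs.ab_seg ⟨⟨i, by lia⟩, hi⟩ f (m0 f hf') hf
      subst h1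
      rcases hd i j hij hj _ hf (left_mem_segment ℝ _ _) with h | h
      exacts [.inl ⟨h.1, hwk.symm⟩, .inr h]
    · exact (Set.disjoint_left.1 (hs.cb_seg ⟨⟨i, by lia⟩, hi⟩) (m1 f hf') hf).elim
    · exact (Set.disjoint_left.1 (hs.cd_seg ⟨⟨i, by lia⟩, hi⟩) hf' hf).elim
    · have h1 := hs.ed_seg ⟨⟨i, by lia⟩, hi⟩ f (m3 f hf') hf
      subst h1
      rcases hd i (k + 3) hij hj _ hf (right_mem_segment ℝ _ _) with h | h
      exacts [by lia, .inr h]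
    · rw [hlink j hj'] at hf'
      rw [hw j (by lia) (by lia) (by lia)]
      exact hd i j hij hj f hf hf'

end PolygonalChain

/-! ### The motion of the whole chain -/

theorem theorem6 (n k : ℕ) (hk : k + 4 ≤ n) (v : ℕ → PolygonalChain.E4)
    (hv : PolygonalChain.IsSimple n v)
    (h1 : ¬ PolygonalChain.StraightAfter v k)
    (h3 : ¬ PolygonalChain.StraightAfter v (k + 2))
    (hquad : v k = v (k + 4) →
      dist (v k) (v (k + 1)) + dist (v (k + 1)) (v (k + 2)) ≠
        dist (v (k + 2)) (v (k + 3)) + dist (v (k + 3)) (v (k + 4))) :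
    ∃ (q : PolygonalChain.E4) (x : ℝ → ℕ → PolygonalChain.E4),
      PolygonalChain.IsLineTracking n v k q x ∧
      StrictMonoOn (fun t => dist (x t (k + 2)) (v k)) (Set.Icc 0 1) ∧
      StrictMonoOn (fun t => dist (x t (k + 2)) (v (k + 4))) (Set.Icc 0 1) ∧
      (∀ t ∈ Set.Icc (0 : ℝ) 1, PolygonalChain.IsSimple n (x t)) ∧
      (PolygonalChain.StraightAfter (x 1) k ∨ PolygonalChain.StraightAfter (x 1) (k + 2)) := by
  have hs := hv.fourLinksSimple hk
  have hb : dist (v k) (v (k + 2)) <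
      dist (v (k + 1)) (v k) + dist (v (k + 1)) (v (k + 2)) := by
    refine lt_of_le_of_ne ?_ fun h => h1 ((angle_eq_pi_iff_dist_eq hs.ab hs.cb).2 h)
    rw [dist_comm (v (k + 1)) (v k)]
    exact dist_triangle _ _ _
  have hd : dist (v (k + 4)) (v (k + 2)) <
      dist (v (k + 3)) (v (k + 4)) + dist (v (k + 3)) (v (k + 2)) := by
    refine lt_of_le_of_ne ?_ fun h => h3 ((angle_eq_pi_iff_dist_eq hs.cd hs.ed).2 ?_)
    · rw [dist_comm (v (k + 3)) (v (k + 4))]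
      exact dist_triangle _ _ _
    · rw [dist_comm (v (k + 2)), add_comm (dist _ _)]
      exact h
  obtain ⟨u, hu, hua, hue, β, δ, hβ, hδ, hβ0, hδ0, ht, hend⟩ :=
    exists_hasStraighteningMotion (by simp) hs (hv.mem_otherLink_left hk)
      (hv.mem_otherLink_right hk) hb hd (by
        intro h
        have := hquad h
        rwa [dist_comm (v k), dist_comm (v (k + 2)), add_comm (dist (v (k + 3)) (v (k + 2)))]
          at this)
  simp only [add_sub_cancel_left] at ht
  set x : ℝ → ℕ → PolygonalChain.E4 := fun t i =>
    if i = k + 1 then β t else if i = k + 2 then v (k + 2) + t • u else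
      if i = k + 3 then δ t else v i with hx
  have x1 : ∀ t, x t (k + 1) = β t := fun t => by simp [hx]
  have x2 : ∀ t, x t (k + 2) = v (k + 2) + t • u := fun t => by simp [hx]
  have x3 : ∀ t, x t (k + 3) = δ t := fun t => by simp [hx]
  have xo : ∀ t i, i ≠ k + 1 → i ≠ k + 2 → i ≠ k + 3 → x t i = v i := fun t i h1 h2 h3 => by
    simp [hx, h1, h2, h3]
  have x0 : ∀ t, x t k = v k := fun t => xo t k (by lia) (by lia) (by lia)
  have x4 : ∀ t, x t (k + 4) = v (k + 4) := fun t => xo t _ (by lia) (by lia) (by lia)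
  have hsx : ∀ t ∈ Set.Icc (0 : ℝ) 1, FourLinksSimple (fun i : PolygonalChain.OtherLink n k => v i.1)
      (fun i => v (i.1 + 1)) (v k) (x t (k + 1)) (x t (k + 2)) (x t (k + 3)) (v (k + 4)) :=
    fun t h => by
      rw [x1, x2, x3]
      exact (ht t h).2.2.2.2
  refine ⟨v (k + 2) + u, x, ⟨fun i => ?_, ?_, fun t h i hi => ?_, fun t _ => xo t, by simpa, ?_⟩,
    ?_, ?_, fun t h => hv.of_fourLinksSimple hk (xo t) (hsx t h), ?_⟩
  · simp only [hx]
    split_ifs <;> fun_prop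
  · funext i
    simp only [hx]
    split_ifs with h1 h2 h3
    · rw [h1, hβ0]
    · rw [h2, zero_smul, add_zero]
    · rw [h3, hδ0]
    · rfl
  · obtain ⟨t1, t2, t3, t4, -⟩ := ht t h
    obtain rfl | rfl | rfl | rfl | hik : i = k ∨ i = k + 1 ∨ i = k + 2 ∨ i = k + 3 ∨
      (i < k ∨ k + 3 < i) := by lia
    · rw [x0, x1, dist_comm, t1, dist_comm]
    · rw [x1, x2, t2]
    · rw [x2, x3, dist_comm, t3, dist_comm]
    · rw [x3, x4, t4]
    · rw [xo t i (by lia) (by lia) (by lia), xo t (i + 1) (by lia) (by lia) (by lia)]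
  · intro t _
    rw [x2, add_sub_cancel_left]
  · simp only [x2]
    exact (strictMonoOn_dist_add_smul hu hua).mono Set.Icc_subset_Ici_self
  · simp only [x2]
    exact (strictMonoOn_dist_add_smul hu hue).mono Set.Icc_subset_Ici_self
  · have h1I : (1 : ℝ) ∈ Set.Icc (0 : ℝ) 1 := by simp
    obtain ⟨t1, t2, t3, t4, hs1⟩ := ht 1 h1I
    rw [one_smul] at t2 t3 hs1
    refine hend.imp (fun h => ?_) fun h => ?_
    · rw [PolygonalChain.StraightAfter, x0, x1, x2, one_smul,
        angle_eq_pi_iff_dist_eq hs1.ab hs1.cb, t1, t2, h]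
    · rw [PolygonalChain.StraightAfter, x2, x3, x4, one_smul,
        angle_eq_pi_iff_dist_eq hs1.cd hs1.ed, t3, t4, dist_comm, h, add_comm]
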